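/- Let $r,p\ge 1$, $R=\mathrm{Mat}_r(\mathbb C)$, and let $J_r(p)\subset GL_{pr}(\mathbb C)$ be the group of invertible matrices $h=\sum_{0\le i<p}h_i\otimes\Lambda^i$ with $h_0\in GL_r(\mathbb C)$, $h_i\in R$, where $\Lambda=(\delta_{i+1,j})$ is the shift matrix of size $p$; it is identified with $(R[w]/(w^p))^\times$ by $h\leftrightarrow\sum_i h_iw^i$. Let $J_r^\circ(p)=\{h\in J_r(p): h_0=1_r\}$. For matrices $h_1,\dots,h_{p-1}\in R$ define $\theta_k\in R$ $(1\le k<p)$ by $$\sum_{1\le j<p}\frac{(-1)^{j+1}}{j}\,(h_1w+\cdots+h_{p-1}w^{p-1})^j=\sum_{1\le k<p}\theta_k\,w^k\quad\text{in } R[w]/(w^p),$$ and write $\theta_k(h)$ for $h=1+\sum_{1\le i<p}h_iw^i\in J_r^\circ(p)$. For a connected complex linear Lie group $S$ let $\tilde S$ be its universal covering group, with the induced complex structure; a character of $S$ or $\tilde S$ is a holomorphic group homomorphism to $\mathbb C^\times$. The simply connected group $J_r^\circ(p)$ is regarded as a subgroup of $\tilde J_r(p)$ by sending $h$ to the homotopy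 class of the path $t\mapsto 1+t(h-1)$. 1. For every character $\chi$ of $\tilde J_r(p)$ there are $\alpha_1,\dots,\alpha_{p-1}\in\mathbb C$ such that $\chi(h)=\exp\left(\sum_{1\le i<p}\alpha_i\,\mathrm{Tr}\,\theta_i(h)\right)$ for all $h\in J_r^\circ(p)$. Conversely, for all $\alpha_1,\dots,\alpha_{p-1}\in\mathbb C$ this formula defines a character of $J_r^\circ(p)$. 2. For every character $\chi$ of $\tilde J_r(p)$ there is $\alpha=(\alpha_0,\dots,\alpha_{p-1})\in\mathbb C^p$ such that, for all $x\in\tilde J_r(p)$ with image $h\in J_r(p)$, $$\chi(x)=\chi_p(x;\alpha):=(\det h_0)^{\alpha_0}\exp\Big(\sum_{1\le i<p}\alpha_i\,\mathrm{Tr}\,\theta_i(h_0^{-1}h)\Big),$$ where $h_0^{-1}h=\sum_{0\le i<p}h_0^{-1}h_iw^i$ and $(\det h_0)^{\alpha_0}=\exp(\alpha_0\log\det h_0)$, with $\log\det h_0$ the continuous branch on $\tilde J_r(p)$ that vanishes at the identity. 3. Let $n_1,\dots,n_\ell\ge1$ and let $H_\lambda=J_r(n_1)\times\cdots\times J_r(n_\ell)$,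 viewed as a group of block diagonal matrices in $GL_{r(n_1+\cdots+n_\ell)}(\mathbb C)$. For $x\in\tilde H_\lambda$ let $x^{(k)}\in\tilde J_r(n_k)$ be its image under the homomorphism induced by the $k$-th projection. For every character $\chi$ of $\tilde H_\lambda$ there are $\alpha^{(k)}\in\mathbb C^{n_k}$ $(1\le k\le\ell)$ such that each $\chi_{n_k}(\,\cdot\,;\alpha^{(k)})$ is a character of $\tilde J_r(n_k)$ and $$\chi(x)=\prod_{1\le k\le\ell}\chi_{n_k}\big(x^{(k)};\alpha^{(k)}\big)\qquad\text{for all }x\in\tilde H_\lambda.$$ -/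

import Mathlib

open scoped unitInterval Topology

noncomputable section

/-! ### The universal covering group -/

/-- The group (under pointwise multiplication) of continuous paths in `G` starting at `1`, with
the compact-open topology. -/
def pathGroup (G : Type*) [Group G] [TopologicalSpace G] [IsTopologicalGroup G] :
    Subgroup C(I, G) where
  carrier := {γ | γ 0 = 1}
  one_mem' := rfl
  mul_mem' {a b} ha hb := by
    have ha' : a 0 = 1 := ha
    have hb' : b 0 = 1 := hb
    simp [ha', hb']
  inv_mem' {a} ha := by
    have ha' : a 0 = 1 := ha
    simp [ha']

section Cover

variable (G : Type*) [Group G] [TopologicalSpace G] [IsTopologicalGroup G]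

/-- The normal subgroup of the loops at `1` which are homotopic, relative to the end points, to
the constant loop. -/
def nullLoops : Subgroup (pathGroup G) where
  carrier := {γ | ContinuousMap.HomotopicRel (γ : C(I, G)) 1 {0, 1}}
  one_mem' := ContinuousMap.HomotopicRel.refl _
  mul_mem' {a b} := by
    rintro ⟨F⟩ ⟨F'⟩
    refine ⟨⟨⟨F.toContinuousMap * F'.toContinuousMap, ?_, ?_⟩, ?_⟩⟩
    · intro x; simp
    · intro x; simp
    · intro t x hx
      have h1 := F.eq_fst t hx
      have h2 := F'.eq_fst t hx
      simp [h1, h2]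
  inv_mem' {a} := by
    rintro ⟨F⟩
    refine ⟨⟨⟨F.toContinuousMap⁻¹, ?_, ?_⟩, ?_⟩⟩
    · intro x; simp
    · intro x; simp
    · intro t x hx
      have h1 := F.eq_fst t hx
      simp [h1]

variable {G} in
lemma mem_nullLoops {γ : pathGroup G} :
    γ ∈ nullLoops G ↔ ContinuousMap.HomotopicRel (γ : C(I, G)) 1 {0, 1} := Iff.rfl

instance nullLoops_normal : (nullLoops G).Normal where
  conj_mem := by
    rintro a ⟨F⟩ g
    refine ⟨⟨⟨((g : C(I, G)).comp ContinuousMap.snd) * F.toContinuousMap *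
      ((g : C(I, G)).comp ContinuousMap.snd)⁻¹, ?_, ?_⟩, ?_⟩⟩
    · intro x; simp
    · intro x; simp
    · intro t x hx
      have h1 := F.eq_fst t hx
      simp [h1]

/-- The universal covering group of `G` (for `G` connected and locally contractible, such as a
connected Lie group): paths issuing from `1` modulo homotopy relative to the end points, with
pointwise multiplication and the quotient of the compact-open topology. -/
abbrev UniversalCover : Type _ := pathGroup G ⧸ nullLoops G

end Cover

namespace UniversalCover

variable {G H : Type*} [Group G] [TopologicalSpace G] [IsTopologicalGroup G]
  [Group H] [TopologicalSpace H] [IsTopologicalGroup H]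

/-- The covering homomorphism: the end point of a path. -/
def proj : UniversalCover G →* G :=
  QuotientGroup.lift (nullLoops G)
    { toFun := fun γ => (γ : C(I, G)) 1
      map_one' := rfl
      map_mul' := fun _ _ => rfl } (by
    intro γ hγ
    exact ContinuousMap.HomotopicRel.fst_eq_snd (mem_nullLoops.1 hγ) (x := 1) (by simp))

/-- Composition of paths with a continuous homomorphism. -/
def mapPath (f : G →ₜ* H) : pathGroup G →* pathGroup H where
  toFun γ := ⟨(f : C(G, H)).comp γ.1, by
    have h : γ.1 0 = 1 := γ.2
    change f (γ.1 0) = 1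
    rw [h, map_one]⟩
  map_one' := by ext t; exact map_one f
  map_mul' a b := by ext t; exact map_mul f _ _

/-- The homomorphism of universal covering groups induced by a continuous homomorphism. -/
def map (f : G →ₜ* H) : UniversalCover G →* UniversalCover H :=
  QuotientGroup.map _ _ (mapPath f) (by
    rintro γ ⟨F⟩
    refine ⟨(F.compContinuousMap (f : C(G, H))).cast rfl ?_⟩
    ext t
    exact map_one f)

/-- `t ↦ γ t`, as a path in the punctured plane. -/
def puncturedPath (γ : pathGroup ℂˣ) : C(I, {z : ℂ // z ≠ 0}) where
  toFun t := ⟨(γ.1 t : ℂ), (γ.1 t).ne_zero⟩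
  continuous_toFun := by
    have : Continuous fun t => ((γ.1 t : ℂˣ) : ℂ) := Units.continuous_val.comp γ.1.continuous
    exact this.subtype_mk _

lemma puncturedPath_zero (γ : pathGroup ℂˣ) :
    puncturedPath γ 0 = ⟨Complex.exp 0, Complex.exp_ne_zero 0⟩ := by
  have h : γ.1 0 = 1 := γ.2
  apply Subtype.ext
  change ((γ.1 0 : ℂˣ) : ℂ) = _
  simp [h]

/-- The continuous logarithm along a path `γ` in `ℂˣ` with `γ 0 = 1`: the unique path `ℓ` in `ℂ`
with `ℓ 0 = 0` and `exp (ℓ t) = γ t`. -/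
def logPath (γ : pathGroup ℂˣ) : C(I, ℂ) :=
  Complex.isCoveringMap_exp.liftPath (puncturedPath γ) 0 (puncturedPath_zero γ)

lemma logPath_zero (γ : pathGroup ℂˣ) : logPath γ 0 = 0 :=
  Complex.isCoveringMap_exp.liftPath_zero _ _ (puncturedPath_zero γ)

lemma exp_logPath (γ : pathGroup ℂˣ) (t : I) : Complex.exp (logPath γ t) = γ.1 t :=
  congrArg Subtype.val
    (congrFun (Complex.isCoveringMap_exp.liftPath_lifts _ _ (puncturedPath_zero γ)) t)

lemma logPath_unique (γ : pathGroup ℂˣ) (l : C(I, ℂ)) (h0 : l 0 = 0)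
    (h : ∀ t, Complex.exp (l t) = γ.1 t) : l = logPath γ :=
  (Complex.isCoveringMap_exp.eq_liftPath_iff' (puncturedPath_zero γ)).2
    ⟨funext fun t => Subtype.ext (h t), h0⟩

/-- The logarithm on the universal covering group of `ℂˣ`: the end value of the continuous
logarithm along a path. -/
def log : UniversalCover ℂˣ →* Multiplicative ℂ :=
  QuotientGroup.lift (nullLoops ℂˣ)
    { toFun := fun γ => Multiplicative.ofAdd (logPath γ 1)
      map_one' := by
        rw [← logPath_unique 1 0 rfl (fun t => by simp)]
        rfl
      map_mul' := fun a b => by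
        rw [← logPath_unique (a * b) (logPath a + logPath b) (by simp [logPath_zero])
          (fun t => by simp [Complex.exp_add, exp_logPath])]
        rfl } (by
    rintro γ ⟨F⟩
    let F' : (puncturedPath γ).HomotopyRel (puncturedPath 1) {0, 1} :=
      { toFun := fun x => ⟨(F x : ℂ), (F x).ne_zero⟩
        continuous_toFun :=
          (Units.continuous_val.comp (map_continuous F)).subtype_mk _
        map_zero_left := fun x => Subtype.ext (congrArg Units.val (F.apply_zero x))
        map_one_left := fun x => Subtype.ext (congrArg Units.val (F.apply_one x))
        prop' := fun t x hx => Subtype.ext (congrArg Units.val (F.eq_fst t hx)) }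
    have h := Complex.isCoveringMap_exp.liftPath_apply_one_eq_of_homotopicRel ⟨F'⟩ 0
      (puncturedPath_zero γ) (puncturedPath_zero 1)
    have h1 : logPath 1 = 0 := (logPath_unique 1 0 rfl (fun t => by simp)).symm
    change logPath γ 1 = 0
    change logPath γ 1 = logPath 1 1 at h
    rw [h, h1]
    rfl)

end UniversalCover

/-! ### Holomorphic characters -/

/-- The matrix entries of an invertible matrix, as a point of a finite-dimensional complex normed
space. -/
def entries {ι : Type*} [Fintype ι] [DecidableEq ι] (g : GL ι ℂ) : ι → ι → ℂ :=
  fun i j => (g : Matrix ι ι ℂ) i j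

/-- `φ` is locally a holomorphic function of the coordinates `e`. When `e` is a holomorphic
immersion and a local embedding of `E` in the coordinate space (the inclusion of a closed complex
subgroup in the matrices, or its composition with the projection of a covering), this says that
`φ` is holomorphic on the complex manifold `E`. -/
def IsHolomorphicIn {E V : Type*} [TopologicalSpace E] [NormedAddCommGroup V] [NormedSpace ℂ V]
    (e : E → V) (φ : E → ℂ) : Prop :=
  ∀ x, ∃ f : V → ℂ, AnalyticAt ℂ f (e x) ∧ ∀ᶠ y in 𝓝 x, φ y = f (e y)

/-- A homomorphism `S → ℂˣ` is a (holomorphic) character of the complex linear group `S`. -/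
def IsCharacter {ι : Type*} [Fintype ι] [DecidableEq ι] {S : Subgroup (GL ι ℂ)}
    (χ : S →* ℂˣ) : Prop :=
  IsHolomorphicIn (fun h : S => entries (h : GL ι ℂ)) fun h => (χ h : ℂ)

/-- A homomorphism to `ℂˣ` from the universal covering group of the complex linear group `S` is a
(holomorphic) character; the complex structure of the covering group is the one pulled back
from `S`. -/
def IsCoverCharacter {ι : Type*} [Fintype ι] [DecidableEq ι] {S : Subgroup (GL ι ℂ)}
    (χ : UniversalCover S →* ℂˣ) : Prop :=
  IsHolomorphicIn
    (fun x : UniversalCover S => entries ((UniversalCover.proj x : S) : GL ι ℂ))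
    fun x => (χ x : ℂ)

/-! ### Jordan groups -/

section Jordan

variable {r p : ℕ}

/-- The block upper triangular Toeplitz matrix `∑ i, c i ⊗ Λ ^ i`, where `Λ` is the shift matrix
of size `p`: the block in position `(a, b)` is `c (b - a)` if `a ≤ b`, and `0` otherwise. -/
def toeplitz (c : Fin p → Matrix (Fin r) (Fin r) ℂ) :
    Matrix (Fin p × Fin r) (Fin p × Fin r) ℂ :=
  Matrix.of fun x y =>
    if x.1 ≤ y.1 then c ⟨y.1.val - x.1.val, lt_of_le_of_lt (Nat.sub_le _ _) y.1.isLt⟩ x.2 y.2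
    else 0

/-- The shift matrix `1 ⊗ Λ`, used only to show that Toeplitz matrices are closed under
multiplication and inversion. -/
def blockShift (r p : ℕ) : Matrix (Fin p × Fin r) (Fin p × Fin r) ℂ :=
  Matrix.of fun x y => if x.1.val + 1 = y.1.val ∧ x.2 = y.2 then 1 else 0

lemma mul_blockShift_succ (M : Matrix (Fin p × Fin r) (Fin p × Fin r) ℂ) (x : Fin p × Fin r)
    (b : ℕ) (hb : b + 1 < p) (j : Fin r) :
    (M * blockShift r p) x (⟨b + 1, hb⟩, j) = M x (⟨b, by omega⟩, j) := by
  rw [Matrix.mul_apply, Finset.sum_eq_single (⟨b, by omega⟩, j)]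
  · simp [blockShift]
  · rintro ⟨a, i⟩ - hne
    have : ¬ (a.val + 1 = b + 1 ∧ i = j) := by
      rintro ⟨h1, h2⟩
      exact hne (Prod.ext (Fin.ext (by simpa using h1)) h2)
    simp [blockShift] at this ⊢
    tauto
  · simp

lemma mul_blockShift_zero (M : Matrix (Fin p × Fin r) (Fin p × Fin r) ℂ) (x : Fin p × Fin r)
    (hp : 0 < p) (j : Fin r) :
    (M * blockShift r p) x (⟨0, hp⟩, j) = 0 := by
  rw [Matrix.mul_apply]
  exact Finset.sum_eq_zero fun z _ => by simp [blockShift]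

lemma blockShift_mul_succ (M : Matrix (Fin p × Fin r) (Fin p × Fin r) ℂ) (y : Fin p × Fin r)
    (a : ℕ) (ha : a + 1 < p) (i : Fin r) :
    (blockShift r p * M) (⟨a, by omega⟩, i) y = M (⟨a + 1, ha⟩, i) y := by
  rw [Matrix.mul_apply, Finset.sum_eq_single (⟨a + 1, ha⟩, i)]
  · simp [blockShift]
  · rintro ⟨b, j⟩ - hne
    have : ¬ (a + 1 = b.val ∧ i = j) := by
      rintro ⟨h1, h2⟩
      exact hne (Prod.ext (Fin.ext (by simpa using h1.symm)) h2.symm)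
    simp [blockShift] at this ⊢
    tauto
  · simp

lemma blockShift_mul_last (M : Matrix (Fin p × Fin r) (Fin p × Fin r) ℂ) (y : Fin p × Fin r)
    (a : ℕ) (ha : a < p) (ha' : ¬ a + 1 < p) (i : Fin r) :
    (blockShift r p * M) (⟨a, ha⟩, i) y = 0 := by
  rw [Matrix.mul_apply]
  refine Finset.sum_eq_zero fun z _ => ?_
  have : ¬ (a + 1 = z.1.val ∧ i = z.2) := fun h => ha' (h.1 ▸ z.1.isLt)
  simp only [blockShift, Matrix.of_apply, if_neg this, zero_mul]

/-- The blocks of the first block row. -/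
def blockCoeff [NeZero p] (M : Matrix (Fin p × Fin r) (Fin p × Fin r) ℂ) (i : Fin p) :
    Matrix (Fin r) (Fin r) ℂ :=
  Matrix.of fun a b => M (0, a) (i, b)

@[simp] lemma blockCoeff_toeplitz [NeZero p] (c : Fin p → Matrix (Fin r) (Fin r) ℂ) :
    blockCoeff (toeplitz c) = c := by
  ext i a b
  simp [blockCoeff, toeplitz]

lemma toeplitz_comm (c : Fin p → Matrix (Fin r) (Fin r) ℂ) :
    toeplitz c * blockShift r p = blockShift r p * toeplitz c := by
  ext ⟨⟨a, ha⟩, i⟩ ⟨⟨b, hb⟩, j⟩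
  by_cases ha' : a + 1 < p
  · rw [blockShift_mul_succ _ _ _ ha']
    cases b with
    | zero => rw [mul_blockShift_zero]; simp [toeplitz]
    | succ b => rw [mul_blockShift_succ]; simp [toeplitz]
  · rw [blockShift_mul_last _ _ _ _ ha']
    cases b with
    | zero => rw [mul_blockShift_zero]
    | succ b =>
      rw [mul_blockShift_succ]
      have : ¬ a ≤ b := by omega
      simp [toeplitz, this]

lemma eq_toeplitz_of_comm [NeZero p] {M : Matrix (Fin p × Fin r) (Fin p × Fin r) ℂ}
    (h : M * blockShift r p = blockShift r p * M) : M = toeplitz (blockCoeff M) := by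
  have key : ∀ (a : ℕ) (ha : a < p) (i : Fin r) (b : ℕ) (hb : b < p) (j : Fin r),
      M (⟨a, ha⟩, i) (⟨b, hb⟩, j) = toeplitz (blockCoeff M) (⟨a, ha⟩, i) (⟨b, hb⟩, j) := by
    intro a
    induction a with
    | zero =>
      intro ha i b hb j
      simp only [toeplitz, blockCoeff, Matrix.of_apply, Fin.mk_le_mk, Nat.zero_le, if_true,
        Nat.sub_zero]
      rfl
    | succ a ih =>
      intro ha i b hb j
      rw [← blockShift_mul_succ M _ a ha i, ← h,
        ← blockShift_mul_succ (toeplitz (blockCoeff M)) _ a ha i, ← toeplitz_comm]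
      cases b with
      | zero => rw [mul_blockShift_zero, mul_blockShift_zero]
      | succ b => rw [mul_blockShift_succ, mul_blockShift_succ, ih]
  ext ⟨⟨a, ha⟩, i⟩ ⟨⟨b, hb⟩, j⟩
  exact key a ha i b hb j

lemma blockCoeff_zero_mul [NeZero p] (M : Matrix (Fin p × Fin r) (Fin p × Fin r) ℂ)
    (d : Fin p → Matrix (Fin r) (Fin r) ℂ) :
    blockCoeff (M * toeplitz d) 0 = blockCoeff M 0 * d 0 := by
  ext a b
  simp only [blockCoeff, Matrix.of_apply, Matrix.mul_apply, Fintype.sum_prod_type]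
  rw [Finset.sum_eq_single 0]
  · simp [toeplitz]
  · intro i _ hi
    simp [toeplitz, hi]
  · simp

/-- The generalized Jordan group `J_r(p)`: the invertible matrices `∑ i, h i ⊗ Λ ^ i`. For
`p ≥ 1` such a matrix is invertible if and only if `h 0` is. -/
def jordanGroup (r p : ℕ) [NeZero p] : Subgroup (GL (Fin p × Fin r) ℂ) where
  carrier := {g | ∃ c : Fin p → Matrix (Fin r) (Fin r) ℂ, IsUnit (c 0) ∧
    (g : Matrix (Fin p × Fin r) (Fin p × Fin r) ℂ) = toeplitz c}
  one_mem' := by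
    have h : (1 : Matrix (Fin p × Fin r) (Fin p × Fin r) ℂ) = toeplitz (blockCoeff 1) :=
      eq_toeplitz_of_comm (by rw [one_mul, mul_one])
    refine ⟨blockCoeff 1, ?_, h⟩
    have : blockCoeff (1 : Matrix (Fin p × Fin r) (Fin p × Fin r) ℂ) 0 = 1 := by
      ext a b
      simp [blockCoeff, Matrix.one_apply]
    rw [this]
    exact isUnit_one
  mul_mem' {g h} := by
    rintro ⟨c, hc, hg⟩ ⟨d, hd, hh⟩
    refine ⟨blockCoeff (toeplitz c * toeplitz d), ?_, ?_⟩
    · rw [blockCoeff_zero_mul, blockCoeff_toeplitz]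
      exact hc.mul hd
    · rw [Units.val_mul, hg, hh]
      refine eq_toeplitz_of_comm ?_
      rw [mul_assoc, toeplitz_comm d, ← mul_assoc, toeplitz_comm c, mul_assoc]
  inv_mem' {g} := by
    rintro ⟨c, hc, hg⟩
    have h1 : ((g⁻¹ : GL (Fin p × Fin r) ℂ) : Matrix (Fin p × Fin r) (Fin p × Fin r) ℂ) =
        toeplitz (blockCoeff ((g⁻¹ : GL (Fin p × Fin r) ℂ) :
          Matrix (Fin p × Fin r) (Fin p × Fin r) ℂ)) := by
      refine eq_toeplitz_of_comm ?_
      have : Commute (g : Matrix (Fin p × Fin r) (Fin p × Fin r) ℂ) (blockShift r p) := by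
        rw [hg]; exact toeplitz_comm c
      exact this.units_inv_left
    refine ⟨_, ?_, h1⟩
    have h2 := blockCoeff_zero_mul (g : Matrix (Fin p × Fin r) (Fin p × Fin r) ℂ)
      (blockCoeff ((g⁻¹ : GL (Fin p × Fin r) ℂ) : Matrix (Fin p × Fin r) (Fin p × Fin r) ℂ))
    rw [← h1, ← Units.val_mul, mul_inv_cancel, hg, blockCoeff_toeplitz] at h2
    have h3 : blockCoeff ((1 : GL (Fin p × Fin r) ℂ) :
        Matrix (Fin p × Fin r) (Fin p × Fin r) ℂ) 0 = 1 := by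
      ext a b
      simp [blockCoeff, Matrix.one_apply]
    rw [h3] at h2
    exact IsUnit.of_mul_eq_one _ (mul_eq_one_comm.1 h2.symm)

variable [NeZero p]

/-- The coefficients `h 0, …, h (p - 1)` of `h = ∑ i, h i ⊗ Λ ^ i`, i.e. of
`h 0 + h 1 w + ⋯ + h (p - 1) w ^ (p - 1)` in `Mat(r)[w] / (w ^ p)`. -/
def jordanCoeff (h : GL (Fin p × Fin r) ℂ) : Fin p → Matrix (Fin r) (Fin r) ℂ :=
  blockCoeff (h : Matrix (Fin p × Fin r) (Fin p × Fin r) ℂ)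

lemma toeplitz_jordanCoeff (h : jordanGroup r p) :
    toeplitz (jordanCoeff h.1) = (h.1 : Matrix (Fin p × Fin r) (Fin p × Fin r) ℂ) := by
  obtain ⟨g, c, hc, hg⟩ := h
  simp only [jordanCoeff, hg, blockCoeff_toeplitz]

lemma jordanCoeff_zero_mul (g h : jordanGroup r p) :
    jordanCoeff (g.1 * h.1) 0 = jordanCoeff g.1 0 * jordanCoeff h.1 0 := by
  have := blockCoeff_zero_mul (g.1 : Matrix (Fin p × Fin r) (Fin p × Fin r) ℂ)
    (jordanCoeff h.1)
  rwa [toeplitz_jordanCoeff, ← Units.val_mul] at this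

lemma jordanCoeff_zero_one : jordanCoeff (1 : GL (Fin p × Fin r) ℂ) 0 = 1 := by
  ext a b
  simp [jordanCoeff, blockCoeff, Matrix.one_apply]

/-- The continuous homomorphism `h ↦ det h₀` from `J_r(p)` to `ℂˣ`. -/
def detZero : jordanGroup r p →ₜ* ℂˣ where
  toMonoidHom := MonoidHom.toHomUnits
    { toFun := fun h => (jordanCoeff h.1 0).det
      map_one' := by simp [jordanCoeff_zero_one]
      map_mul' := fun g h => by
        change (jordanCoeff (g.1 * h.1) 0).det = _
        rw [jordanCoeff_zero_mul, Matrix.det_mul] }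
  continuous_toFun := by
    have h1 : Continuous fun h : jordanGroup r p => (jordanCoeff h.1 0).det := by
      refine Continuous.matrix_det (continuous_matrix fun a b => ?_)
      exact (Units.continuous_val.comp continuous_subtype_val).matrix_elem _ _
    rw [Units.continuous_iff]
    exact ⟨h1, h1.comp continuous_inv⟩

/-- The unipotent group `J_r°(p)`: the matrices `∑ i, h i ⊗ Λ ^ i` with `h 0 = 1`. -/
def unipotentGroup (r p : ℕ) [NeZero p] : Subgroup (GL (Fin p × Fin r) ℂ) where
  carrier := {g | ∃ c : Fin p → Matrix (Fin r) (Fin r) ℂ, c 0 = 1 ∧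
    (g : Matrix (Fin p × Fin r) (Fin p × Fin r) ℂ) = toeplitz c}
  one_mem' := by
    obtain ⟨c, hc, h⟩ := (jordanGroup r p).one_mem
    refine ⟨c, ?_, h⟩
    have := jordanCoeff_zero_one (r := r) (p := p)
    rwa [jordanCoeff, h, blockCoeff_toeplitz] at this
  mul_mem' {g h} := by
    rintro ⟨c, hc, hg⟩ ⟨d, hd, hh⟩
    obtain ⟨e, -, he⟩ := (jordanGroup r p).mul_mem (x := g) (y := h)
      ⟨c, hc ▸ isUnit_one, hg⟩ ⟨d, hd ▸ isUnit_one, hh⟩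
    refine ⟨e, ?_, he⟩
    have := blockCoeff_zero_mul (g : Matrix (Fin p × Fin r) (Fin p × Fin r) ℂ) d
    rwa [← hh, ← Units.val_mul, he, hg, blockCoeff_toeplitz, blockCoeff_toeplitz, hc, hd,
      one_mul] at this
  inv_mem' {g} := by
    rintro ⟨c, hc, hg⟩
    have hgJ : g ∈ jordanGroup r p := ⟨c, hc ▸ isUnit_one, hg⟩
    obtain ⟨e, -, he⟩ := (jordanGroup r p).inv_mem hgJ
    refine ⟨e, ?_, he⟩
    have := blockCoeff_zero_mul (g : Matrix (Fin p × Fin r) (Fin p × Fin r) ℂ) e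
    rw [← he, ← Units.val_mul, mul_inv_cancel, hg, blockCoeff_toeplitz, hc, one_mul] at this
    rw [← this]
    exact jordanCoeff_zero_one

lemma unipotentGroup_le : unipotentGroup r p ≤ jordanGroup r p := by
  rintro g ⟨c, hc, hg⟩
  exact ⟨c, hc ▸ isUnit_one, hg⟩

/-- The inclusion of `J_r°(p)` in `J_r(p)`. -/
def unipotentIncl : unipotentGroup r p →ₜ* jordanGroup r p where
  toMonoidHom := Subgroup.inclusion unipotentGroup_le
  continuous_toFun := continuous_inclusion unipotentGroup_le

/-! ### The inclusion of the simply connected group `J_r°(p)` in the universal cover -/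

lemma det_toeplitz {c : Fin p → Matrix (Fin r) (Fin r) ℂ} (hc : c 0 = 1) :
    (toeplitz c).det = 1 := by
  have hT : (toeplitz c).BlockTriangular (Prod.fst : Fin p × Fin r → Fin p) := by
    intro x y hxy
    simp [toeplitz, not_le.2 hxy]
  rw [hT.det_fintype]
  refine Finset.prod_eq_one fun k _ => ?_
  have : (toeplitz c).toSquareBlock Prod.fst k = 1 := by
    ext ⟨⟨a, i⟩, ha⟩ ⟨⟨b, j⟩, hb⟩
    dsimp only at ha hb
    subst ha hb
    simp [Matrix.toSquareBlock, Matrix.toSquareBlockProp, toeplitz, hc, Matrix.one_apply]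
  rw [this, Matrix.det_one]

/-- The element `(1 - s) • 1 + s • h` of `J_r°(p)`. -/
def scaleMatrix (s : ℝ) (h : unipotentGroup r p) : Matrix (Fin p × Fin r) (Fin p × Fin r) ℂ :=
  (1 - (s : ℂ)) • (1 : Matrix (Fin p × Fin r) (Fin p × Fin r) ℂ) +
    (s : ℂ) • (h.1 : Matrix (Fin p × Fin r) (Fin p × Fin r) ℂ)

lemma scaleMatrix_eq (s : ℝ) (h : unipotentGroup r p) :
    ∃ c : Fin p → Matrix (Fin r) (Fin r) ℂ, c 0 = 1 ∧ scaleMatrix s h = toeplitz c := by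
  obtain ⟨e, he0, he⟩ := (unipotentGroup r p).one_mem
  obtain ⟨c, hc0, hc⟩ := h.2
  refine ⟨(1 - (s : ℂ)) • e + (s : ℂ) • c, ?_, ?_⟩
  · rw [Pi.add_apply, Pi.smul_apply, Pi.smul_apply, he0, hc0, ← add_smul, sub_add_cancel, one_smul]
  · rw [Units.val_one] at he
    rw [scaleMatrix, hc, he]
    ext x y
    by_cases hxy : x.1 ≤ y.1 <;> simp [toeplitz, hxy]

lemma det_scaleMatrix (s : ℝ) (h : unipotentGroup r p) : (scaleMatrix s h).det = 1 := by
  obtain ⟨c, hc0, hc⟩ := scaleMatrix_eq s h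
  rw [hc, det_toeplitz hc0]

lemma continuous_scaleMatrix :
    Continuous fun x : ℝ × unipotentGroup r p => scaleMatrix x.1 x.2 := by
  have h1 : Continuous fun x : ℝ × unipotentGroup r p =>
      (x.2.1 : Matrix (Fin p × Fin r) (Fin p × Fin r) ℂ) :=
    Units.continuous_val.comp (continuous_subtype_val.comp continuous_snd)
  have h2 : Continuous fun x : ℝ × unipotentGroup r p => (x.1 : ℂ) :=
    Complex.continuous_ofReal.comp continuous_fst
  exact ((continuous_const.sub h2).smul continuous_const).add (h2.smul h1)

/-- The contraction `(s, h) ↦ (1 - s) • 1 + s • h` of `J_r°(p)`. -/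
def scale : C(ℝ × unipotentGroup r p, unipotentGroup r p) where
  toFun x := ⟨⟨scaleMatrix x.1 x.2, (scaleMatrix x.1 x.2).adjugate,
      by rw [Matrix.mul_adjugate, det_scaleMatrix, one_smul],
      by rw [Matrix.adjugate_mul, det_scaleMatrix, one_smul]⟩, scaleMatrix_eq x.1 x.2⟩
  continuous_toFun := by
    refine Continuous.subtype_mk ?_ _
    rw [Units.continuous_iff]
    exact ⟨continuous_scaleMatrix, continuous_scaleMatrix.matrix_adjugate⟩

lemma scale_val (s : ℝ) (h : unipotentGroup r p) :
    ((scale (s, h)).1 : Matrix (Fin p × Fin r) (Fin p × Fin r) ℂ) = scaleMatrix s h := rfl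

lemma scale_zero (h : unipotentGroup r p) : scale (0, h) = 1 :=
  Subtype.ext (Units.ext (by rw [scale_val]; simp [scaleMatrix]))

lemma scale_one (h : unipotentGroup r p) : scale (1, h) = h :=
  Subtype.ext (Units.ext (by rw [scale_val]; simp [scaleMatrix]))

lemma scale_self_one (s : ℝ) : scale (s, (1 : unipotentGroup r p)) = 1 :=
  Subtype.ext (Units.ext (by
    rw [scale_val, scaleMatrix, OneMemClass.coe_one, Units.val_one, ← add_smul, sub_add_cancel,
      one_smul]))

/-- Every loop in `J_r°(p)` is null-homotopic. -/
lemma mem_nullLoops_unipotentGroup (γ : pathGroup (unipotentGroup r p)) (h1 : γ.1 1 = 1) :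
    γ ∈ nullLoops (unipotentGroup r p) := by
  have h0 : γ.1 0 = 1 := γ.2
  refine ⟨⟨⟨⟨fun x => scale (1 - (x.1 : ℝ), γ.1 x.2), by fun_prop⟩, ?_, ?_⟩, ?_⟩⟩
  · intro x; simp [scale_one]
  · intro x; simp [scale_zero]
  · rintro t x (rfl | rfl)
    · simp [h0, scale_self_one]
    · simp [h1, scale_self_one]

/-- The straight path `t ↦ 1 + t (h - 1)` from `1` to `h` in `J_r°(p)`. -/
def straightPath (h : unipotentGroup r p) : pathGroup (unipotentGroup r p) :=
  ⟨⟨fun t => scale ((t : ℝ), h), by fun_prop⟩, by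
    change scale (((0 : I) : ℝ), h) = 1
    simp [scale_zero]⟩

lemma straightPath_one (h : unipotentGroup r p) : (straightPath h).1 1 = h := by
  change scale (((1 : I) : ℝ), h) = h
  simp [scale_one]

/-- The inclusion of `J_r°(p)` in the universal covering group of `J_r(p)`: it sends `h` to the
class of the straight path from `1` to `h`. It lifts the inclusion of `J_r°(p)` in `J_r(p)`, and
the paths used stay in `J_r°(p)`. -/
def unipotentLift : unipotentGroup r p →* UniversalCover (jordanGroup r p) :=
  (UniversalCover.map unipotentIncl).comp
    (MonoidHom.mk' (fun h => (straightPath h : UniversalCover (unipotentGroup r p)))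
      (fun g h => by
        rw [← QuotientGroup.mk_mul, QuotientGroup.eq]
        apply mem_nullLoops_unipotentGroup
        change ((straightPath (g * h)).1 1)⁻¹ *
          ((straightPath g).1 1 * (straightPath h).1 1) = 1
        simp [straightPath_one]))

/-! ### The characters -/

/-- `θ_k` of the sequence `c`: the coefficient of `w ^ k` (`1 ≤ k < p`) in
`log (1 + c 1 w + ⋯ + c (p - 1) w ^ (p - 1)) =
  ∑_{1 ≤ j < p} (-1) ^ (j + 1) / j • (c 1 w + ⋯ + c (p - 1) w ^ (p - 1)) ^ j`
modulo `w ^ p`, where `w` commutes with the matrices `c i`. -/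
def theta (c : Fin p → Matrix (Fin r) (Fin r) ℂ) (k : Fin p) : Matrix (Fin r) (Fin r) ℂ :=
  (∑ j ∈ Finset.Ico 1 p, ((-1 : ℂ) ^ (j + 1) / (j : ℂ)) •
    (∑ i ∈ Finset.Ioi (0 : Fin p),
      Polynomial.C (c i) * (Polynomial.X : Polynomial (Matrix (Fin r) (Fin r) ℂ)) ^ i.val) ^ j
  ).coeff k.val

/-- `exp (∑_{1 ≤ i < p} α i * Tr (θ_i c))`. -/
def expTraceTheta (α : Fin p → ℂ) (c : Fin p → Matrix (Fin r) (Fin r) ℂ) : ℂ :=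
  Complex.exp (∑ i ∈ Finset.Ioi (0 : Fin p), α i * (theta c i).trace)

/-- The coefficients of `h₀⁻¹ h`, i.e. `1, h₀⁻¹ h₁, …, h₀⁻¹ h_{p-1}`. -/
def reducedCoeff (h : GL (Fin p × Fin r) ℂ) : Fin p → Matrix (Fin r) (Fin r) ℂ :=
  fun i => (jordanCoeff h 0)⁻¹ * jordanCoeff h i

/-- `log det h₀` on the universal covering group of `J_r(p)`, normalized to be `0` at `1`. -/
def logDetZero (x : UniversalCover (jordanGroup r p)) : ℂ :=
  Multiplicative.toAdd (UniversalCover.log (UniversalCover.map detZero x))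

/-- `(det h₀) ^ α₀ * exp (∑_{1 ≤ i < p} α i * Tr (θ_i (h₀⁻¹ h)))` on the universal covering group
of `J_r(p)`. -/
def jordanCharacter (α : Fin p → ℂ) (x : UniversalCover (jordanGroup r p)) : ℂ :=
  Complex.exp (α 0 * logDetZero x) *
    expTraceTheta α (reducedCoeff (UniversalCover.proj x : jordanGroup r p).1)

end Jordan

/-! ### The group `H_λ` -/

section Product

variable {ℓ : ℕ} (r : ℕ) (n : Fin ℓ → ℕ) [∀ k, NeZero (n k)]

/-- `(h⁽¹⁾, …, h⁽ˡ⁾) ↦ diag (h⁽¹⁾, …, h⁽ˡ⁾)`. -/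
def blockDiagHom : (∀ k, jordanGroup r (n k)) →* GL (Σ k, Fin (n k) × Fin r) ℂ where
  toFun g :=
    ⟨Matrix.blockDiagonal' fun k => ((g k).1 : Matrix (Fin (n k) × Fin r) (Fin (n k) × Fin r) ℂ),
      Matrix.blockDiagonal' fun k =>
        (((g k).1⁻¹ : GL (Fin (n k) × Fin r) ℂ) :
          Matrix (Fin (n k) × Fin r) (Fin (n k) × Fin r) ℂ),
      by
        rw [← Matrix.blockDiagonal'_mul, ← Matrix.blockDiagonal'_one]
        congr 1
        funext k
        rw [← Units.val_mul, mul_inv_cancel]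
        rfl,
      by
        rw [← Matrix.blockDiagonal'_mul, ← Matrix.blockDiagonal'_one]
        congr 1
        funext k
        rw [← Units.val_mul, inv_mul_cancel]
        rfl⟩
  map_one' := Units.ext Matrix.blockDiagonal'_one
  map_mul' g h := Units.ext (Matrix.blockDiagonal'_mul
    (fun k => ((g k).1 : Matrix (Fin (n k) × Fin r) (Fin (n k) × Fin r) ℂ))
    (fun k => ((h k).1 : Matrix (Fin (n k) × Fin r) (Fin (n k) × Fin r) ℂ)))

/-- `H_λ = J_r(n₁) × ⋯ × J_r(n_ℓ)`, as a group of block diagonal matrices. -/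
def hGroup : Subgroup (GL (Σ k, Fin (n k) × Fin r) ℂ) := (blockDiagHom r n).range

variable {r n}

lemma blockDiagHom_apply (g : ∀ k, jordanGroup r (n k)) (k : Fin ℓ) (a b : Fin (n k) × Fin r) :
    (blockDiagHom r n g : Matrix (Σ k, Fin (n k) × Fin r) (Σ k, Fin (n k) × Fin r) ℂ) ⟨k, a⟩ ⟨k, b⟩ =
      ((g k).1 : Matrix (Fin (n k) × Fin r) (Fin (n k) × Fin r) ℂ) a b :=
  Matrix.blockDiagonal'_apply_eq
    (fun k => ((g k).1 : Matrix (Fin (n k) × Fin r) (Fin (n k) × Fin r) ℂ)) k a b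

lemma blockDiagHom_injective : Function.Injective (blockDiagHom r n) := by
  intro g h hgh
  funext k
  refine Subtype.ext (Units.ext ?_)
  ext a b
  rw [← blockDiagHom_apply, ← blockDiagHom_apply, hgh]

/-- The `k`-th block, `h ↦ h⁽ᵏ⁾`, as a homomorphism. -/
def hBlockHom (k : Fin ℓ) : hGroup r n →* jordanGroup r (n k) :=
  (Pi.evalMonoidHom (fun k => jordanGroup r (n k)) k).comp
    (MonoidHom.ofInjective (blockDiagHom_injective (r := r) (n := n))).symm.toMonoidHom

lemma hBlockHom_apply (k : Fin ℓ) (h : hGroup r n) (a b : Fin (n k) × Fin r) :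
    ((hBlockHom k h).1 : Matrix (Fin (n k) × Fin r) (Fin (n k) × Fin r) ℂ) a b =
      (h.1 : Matrix (Σ k, Fin (n k) × Fin r) (Σ k, Fin (n k) × Fin r) ℂ) ⟨k, a⟩ ⟨k, b⟩ := by
  obtain ⟨g, rfl⟩ :=
    (MonoidHom.ofInjective (blockDiagHom_injective (r := r) (n := n))).surjective h
  change _ = (blockDiagHom r n g : Matrix (Σ k, Fin (n k) × Fin r) (Σ k, Fin (n k) × Fin r) ℂ) ⟨k, a⟩ ⟨k, b⟩
  rw [blockDiagHom_apply]
  have : hBlockHom k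
      (MonoidHom.ofInjective (blockDiagHom_injective (r := r) (n := n)) g) = g k :=
    congrFun (MulEquiv.symm_apply_apply
      (MonoidHom.ofInjective (blockDiagHom_injective (r := r) (n := n))) g) k
  rw [this]

/-- The continuous homomorphism `H_λ → J_r(n_k)`, `h ↦ h⁽ᵏ⁾`. -/
def hBlock (k : Fin ℓ) : hGroup r n →ₜ* jordanGroup r (n k) where
  toMonoidHom := hBlockHom k
  continuous_toFun := by
    have h1 : Continuous fun h : hGroup r n =>
        ((hBlockHom k h).1 : Matrix (Fin (n k) × Fin r) (Fin (n k) × Fin r) ℂ) := by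
      refine continuous_matrix fun a b => ?_
      simp only [hBlockHom_apply]
      exact (Units.continuous_val.comp continuous_subtype_val).matrix_elem _ _
    refine continuous_induced_rng.2 ?_
    rw [Units.continuous_iff]
    refine ⟨h1, ?_⟩
    have h2 := h1.comp (continuous_inv (G := hGroup r n))
    convert h2 using 2 with h
    simp

end Product

end

/-! The Lie algebra of $J_r(p)$ is the whole algebra $T$ of block Toeplitz matrices, a copy of
$R[w]/(w^p)$, and a character of a connected group is determined by its differential at the
identity. So the proof finds all possible differentials and exhibits a homomorphism for each.

Near $1$ a character is a function of the matrix entries; let $L$ be its differential. The target is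
commutative, so the character is invariant under conjugation and $L(gXg^{-1})=L(X)$
(`differential_conj`). Taking $g=1+\delta A$ and $X=\varepsilon Bg$ gives $L(AB)=L(BA)$ on $T$
(`differential_mul_comm`). Applied to $A\otimes\Lambda^i$, this forces
$L(M)=\sum_i\alpha_i\mathrm{Tr}\,M_i$ (`exists_eq_traceForm`).

Conversely, let $\tau=\sum_i\alpha_i\mathrm{Tr}(\cdot)_i$. Since $\tau$ kills commutators, the
derivative of $\tau(\log(1+N))$ is $\tau((1+N)^{-1}N')$, hence $\tau\circ\log$ turns products of
unipotent elements into sums (`traceForm_truncLog_mul`). Passing from $h$ to $h_0^{-1}h$ is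
multiplicative up to conjugation by $h_0$, which $\tau$ does not see, so `jordanCharacter` is a
homomorphism; its differential is exactly $\tau$ (`hasDerivAt_localJordanCharacter`).

The quotient of the given character by the `jordanCharacter` with the same $\alpha$ has zero
differential. By translation it is constant along lifted segments issuing from $1$, hence trivial
near $1$, hence trivial because the cover is connected (`eq_one_of_hasDerivAt`). Only connectedness
and the continuous local section by straight paths are needed, not the covering property of the
projection to $J_r(p)$.

On $J_r^\circ(p)$ the factor $\log\det h_0$ vanishes, which gives the restriction formula. For
$H_\lambda$, a path is the product of its block components, so a character is the product of its
restrictions to the factors (`apply_eq_prod_hIncl`). -/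

noncomputable section

/-! ### Topology of the universal covering group -/

namespace UniversalCover

section Topology

variable {G H : Type*} [Group G] [TopologicalSpace G] [IsTopologicalGroup G]
  [Group H] [TopologicalSpace H] [IsTopologicalGroup H]

/-- Makes the path group and its quotient topological groups; openness of the quotient map and
continuity of translations on the cover rest on it. -/
instance : IsTopologicalGroup C(I, G) where
  continuous_inv := ContinuousMap.continuous_postcomp ⟨fun g : G => g⁻¹, continuous_inv⟩

lemma proj_mk (γ : pathGroup G) : proj (γ : UniversalCover G) = γ.1 1 := rfl

lemma continuous_proj : Continuous (proj : UniversalCover G → G) :=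
  continuous_quot_lift _ ((continuous_eval_const (1 : I)).comp continuous_subtype_val)

lemma continuous_mapPath (f : G →ₜ* H) : Continuous (mapPath f) :=
  ((ContinuousMap.continuous_postcomp (f : C(G, H))).comp continuous_subtype_val).subtype_mk _

lemma continuous_map (f : G →ₜ* H) : Continuous (map f) :=
  continuous_quot_lift _ (continuous_quot_mk.comp (continuous_mapPath f))

lemma proj_map (f : G →ₜ* H) (x : UniversalCover G) : proj (map f x) = f (proj x) := by
  obtain ⟨γ, rfl⟩ := QuotientGroup.mk_surjective x
  rfl

/-- The quotient map of a topological group is open, so local statements on the cover may be checked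
on paths uniformly close to the constant one. -/
lemma eventually_mk {P : UniversalCover G → Prop} (h : ∀ᶠ γ : pathGroup G in 𝓝 1, P γ) :
    ∀ᶠ x in 𝓝 (1 : UniversalCover G), P x := by
  have := (QuotientGroup.isOpenMap_coe (N := nullLoops G)).image_mem_nhds h
  refine Filter.mem_of_superset this ?_
  rintro _ ⟨γ, hγ, rfl⟩
  exact hγ

/-- The initial segments `s ↦ γ (t s)` of a path. -/
def initialSegment (γ : pathGroup G) : C(I, pathGroup G) where
  toFun t := ⟨(γ.1.comp ⟨fun s : I => t * s, by fun_prop⟩), by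
    have : γ.1 0 = 1 := γ.2
    change γ.1 (t * 0) = 1
    rwa [mul_zero]⟩
  continuous_toFun := by
    refine Continuous.subtype_mk ?_ _
    exact (ContinuousMap.curry ⟨fun x : I × I => γ.1 (x.1 * x.2), by fun_prop⟩).continuous

/-- Shrinking a path through its initial segments deforms it to the constant path. This needs no
hypothesis on `G`, and connectedness descends to the quotient. -/
instance : PathConnectedSpace (pathGroup G) where
  nonempty := ⟨1⟩
  joined := by
    have h : ∀ γ : pathGroup G, Joined 1 γ := fun γ =>
      ⟨{ toContinuousMap := initialSegment γ
         source' := by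
           ext s
           have : γ.1 0 = 1 := γ.2
           change γ.1 (0 * s) = 1
           rwa [zero_mul]
         target' := by
           ext s
           change γ.1 (1 * s) = γ.1 s
           rw [one_mul] }⟩
    exact fun a b => (h a).symm.trans (h b)

instance : PreconnectedSpace (UniversalCover G) :=
  inferInstanceAs (PreconnectedSpace (Quotient (QuotientGroup.leftRel (nullLoops G))))

/-- The kernel is an open subgroup, therefore also closed, and the cover is connected. -/
lemma eq_one_of_eventually {K : Type*} [Group K] (ψ : UniversalCover G →* K)
    (h : ∀ᶠ x in 𝓝 1, ψ x = 1) (x : UniversalCover G) : ψ x = 1 := by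
  have ho : IsOpen (ψ.ker : Set (UniversalCover G)) :=
    Subgroup.isOpen_of_mem_nhds ψ.ker (g := 1) (by
      filter_upwards [h] with y hy using hy)
  have hc : IsClosed (ψ.ker : Set (UniversalCover G)) := Subgroup.isClosed_of_isOpen _ ho
  have : (ψ.ker : Set (UniversalCover G)) = Set.univ :=
    IsClopen.eq_univ ⟨hc, ho⟩ ⟨1, one_mem _⟩
  exact (Set.eq_univ_iff_forall.1 this x)

lemma log_mk (γ : pathGroup ℂˣ) :
    Multiplicative.toAdd (log (γ : UniversalCover ℂˣ)) = logPath γ 1 := rfl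

/-- Paths that stay in the slit plane form a neighbourhood of the constant path, by compactness of
`I`. Along such a path the principal logarithm is a continuous lift starting at $0$, so it is
`logPath` by uniqueness. -/
lemma log_eventuallyEq :
    ∀ᶠ x in 𝓝 (1 : UniversalCover ℂˣ),
      Multiplicative.toAdd (log x) = Complex.log ((proj x : ℂˣ) : ℂ) := by
  apply eventually_mk
  have ho : IsOpen {u : ℂˣ | (u : ℂ) ∈ Complex.slitPlane} :=
    Complex.isOpen_slitPlane.preimage Units.continuous_val
  have h1 : ∀ᶠ γ in 𝓝 (1 : pathGroup ℂˣ),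
      Set.MapsTo (γ.1 : I → ℂˣ) Set.univ {u : ℂˣ | (u : ℂ) ∈ Complex.slitPlane} := by
    refine continuous_subtype_val.continuousAt.eventually
      ((ContinuousMap.isOpen_setOfPred_mapsTo isCompact_univ ho).mem_nhds ?_)
    intro t _
    simp
  filter_upwards [h1] with γ hγ
  rw [log_mk, proj_mk]
  have := logPath_unique γ ⟨fun t => Complex.log (γ.1 t), by
    have h2 : Continuous fun t : I => ((γ.1 t : ℂˣ) : ℂ) :=
      Units.continuous_val.comp γ.1.continuous
    exact h2.clog fun t => hγ (Set.mem_univ t)⟩ (by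
      have : γ.1 0 = 1 := γ.2
      simp [this]) (fun t => by
      simp [Complex.exp_log])
  rw [← this]
  rfl

end Topology

end UniversalCover

/-! ### The algebra $R[w]/(w^p)$ as block Toeplitz matrices, its trace forms, and $\theta_k$ as
coefficients of a logarithm -/

section ToeplitzAlgebra

variable {r p : ℕ}

/-- The algebra of the block Toeplitz matrices `∑ i, c i ⊗ Λ ^ i`, i.e. of the matrices which
commute with the block shift. -/
def toeplitzAlgebra (r p : ℕ) : Subalgebra ℂ (Matrix (Fin p × Fin r) (Fin p × Fin r) ℂ) :=
  Subalgebra.centralizer ℂ {blockShift r p}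

lemma mem_toeplitzAlgebra {M : Matrix (Fin p × Fin r) (Fin p × Fin r) ℂ} :
    M ∈ toeplitzAlgebra r p ↔ M * blockShift r p = blockShift r p * M := by
  simp [toeplitzAlgebra, Subalgebra.mem_centralizer_iff, eq_comm]

lemma toeplitz_mem (c : Fin p → Matrix (Fin r) (Fin r) ℂ) : toeplitz c ∈ toeplitzAlgebra r p :=
  mem_toeplitzAlgebra.2 (toeplitz_comm c)

/-- The truncated logarithmic series `∑_{1 ≤ j ≤ p} (-1) ^ (j + 1) / j • N ^ j`, which is
`log (1 + N)` if `N ^ (p + 1) = 0`. -/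
def truncLog (N : Matrix (Fin p × Fin r) (Fin p × Fin r) ℂ) :
    Matrix (Fin p × Fin r) (Fin p × Fin r) ℂ :=
  ∑ j ∈ Finset.range (p + 1), ((-1 : ℂ) ^ (j + 1) / (j : ℂ)) • N ^ j

lemma truncLog_mem {N : Matrix (Fin p × Fin r) (Fin p × Fin r) ℂ}
    (hN : N ∈ toeplitzAlgebra r p) : truncLog N ∈ toeplitzAlgebra r p :=
  Subalgebra.sum_mem _ fun _ _ => Subalgebra.smul_mem _ (pow_mem hN _) _

lemma truncLog_conj {g g' N : Matrix (Fin p × Fin r) (Fin p × Fin r) ℂ} (h : g' * g = 1) :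
    truncLog (g * N * g') = g * truncLog N * g' := by
  have hp : ∀ j : ℕ, (g * N * g') ^ j = g * N ^ j * g' := by
    intro j
    induction j with
    | zero => rw [pow_zero, pow_zero, mul_one, mul_eq_one_comm.1 h]
    | succ j ih =>
      rw [pow_succ, ih, pow_succ]
      calc g * N ^ j * g' * (g * N * g') = g * N ^ j * (g' * g) * N * g' := by noncomm_ring
        _ = _ := by rw [h]; noncomm_ring
  simp only [truncLog, hp, Finset.mul_sum, Finset.sum_mul, mul_smul_comm, smul_mul_assoc]

variable [NeZero p]

lemma toeplitz_blockCoeff {M : Matrix (Fin p × Fin r) (Fin p × Fin r) ℂ}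
    (hM : M ∈ toeplitzAlgebra r p) : toeplitz (blockCoeff M) = M :=
  (eq_toeplitz_of_comm (mem_toeplitzAlgebra.1 hM)).symm

lemma eq_of_blockCoeff_eq {M N : Matrix (Fin p × Fin r) (Fin p × Fin r) ℂ}
    (hM : M ∈ toeplitzAlgebra r p) (hN : N ∈ toeplitzAlgebra r p)
    (h : blockCoeff M = blockCoeff N) : M = N := by
  rw [← toeplitz_blockCoeff hM, h, toeplitz_blockCoeff hN]

/-- `blockCoeff` as a linear map. -/
def blockCoeffₗ (r p : ℕ) [NeZero p] :
    Matrix (Fin p × Fin r) (Fin p × Fin r) ℂ →ₗ[ℂ] Fin p → Matrix (Fin r) (Fin r) ℂ where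
  toFun := blockCoeff
  map_add' _ _ := rfl
  map_smul' _ _ := rfl

lemma blockCoeff_add (M N : Matrix (Fin p × Fin r) (Fin p × Fin r) ℂ) :
    blockCoeff (M + N) = blockCoeff M + blockCoeff N := rfl

lemma blockCoeff_sub (M N : Matrix (Fin p × Fin r) (Fin p × Fin r) ℂ) :
    blockCoeff (M - N) = blockCoeff M - blockCoeff N := rfl

lemma blockCoeff_smul (a : ℂ) (M : Matrix (Fin p × Fin r) (Fin p × Fin r) ℂ) :
    blockCoeff (a • M) = a • blockCoeff M := rfl

/-- The Cauchy product modulo $w^p$. The subtraction is that of `Fin p`, but $k\le i$, so it does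
not wrap around. -/
lemma blockCoeff_mul (M : Matrix (Fin p × Fin r) (Fin p × Fin r) ℂ)
    {N : Matrix (Fin p × Fin r) (Fin p × Fin r) ℂ} (hN : N ∈ toeplitzAlgebra r p) (i : Fin p) :
    blockCoeff (M * N) i = ∑ k ∈ Finset.Iic i, blockCoeff M k * blockCoeff N (i - k) := by
  ext a b
  have h : ∀ k : Fin p, ∀ d : Fin r, N (k, d) (i, b) =
      if k ≤ i then blockCoeff N (i - k) d b else 0 := by
    intro k d
    conv_lhs => rw [← toeplitz_blockCoeff hN]
    simp only [toeplitz, Matrix.of_apply]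
    split_ifs with hk
    · have : (⟨i.val - k.val, lt_of_le_of_lt (Nat.sub_le _ _) i.isLt⟩ : Fin p) = i - k :=
        Fin.ext (Fin.sub_val_of_le hk).symm
      rw [this]
    · rfl
  rw [Matrix.sum_apply]
  simp only [blockCoeff, Matrix.of_apply, Matrix.mul_apply, Fintype.sum_prod_type] at h ⊢
  simp only [h, mul_ite, mul_zero]
  have h2 : (Finset.Iic i) = Finset.univ.filter (· ≤ i) := by ext; simp
  rw [h2, Finset.sum_filter]
  refine Finset.sum_congr rfl fun k _ => ?_
  split_ifs <;> simp

/-- The ideal of the matrices `∑ i, c i ⊗ Λ ^ i` with `c 0 = 0`. -/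
def toeplitzRadical (r p : ℕ) [NeZero p] :
    Submodule ℂ (Matrix (Fin p × Fin r) (Fin p × Fin r) ℂ) where
  carrier := {M | M ∈ toeplitzAlgebra r p ∧ blockCoeff M 0 = 0}
  zero_mem' := ⟨zero_mem _, rfl⟩
  add_mem' ha hb := ⟨add_mem ha.1 hb.1, by
    rw [blockCoeff_add, Pi.add_apply, ha.2, hb.2, add_zero]⟩
  smul_mem' a M hM := ⟨Subalgebra.smul_mem _ hM.1 a, by
    rw [blockCoeff_smul, Pi.smul_apply, hM.2, smul_zero]⟩

lemma blockCoeff_mul_zero (M : Matrix (Fin p × Fin r) (Fin p × Fin r) ℂ)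
    {N : Matrix (Fin p × Fin r) (Fin p × Fin r) ℂ} (hN : N ∈ toeplitzAlgebra r p) :
    blockCoeff (M * N) 0 = blockCoeff M 0 * blockCoeff N 0 := by
  have := blockCoeff_zero_mul M (blockCoeff N)
  rwa [toeplitz_blockCoeff hN] at this

lemma mul_mem_toeplitzRadical {M N : Matrix (Fin p × Fin r) (Fin p × Fin r) ℂ}
    (hM : M ∈ toeplitzAlgebra r p) (hN : N ∈ toeplitzRadical r p) :
    M * N ∈ toeplitzRadical r p :=
  ⟨mul_mem hM hN.1, by rw [blockCoeff_mul_zero M hN.1, hN.2, mul_zero]⟩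

lemma mul_mem_toeplitzRadical' {M N : Matrix (Fin p × Fin r) (Fin p × Fin r) ℂ}
    (hM : M ∈ toeplitzRadical r p) (hN : N ∈ toeplitzAlgebra r p) :
    M * N ∈ toeplitzRadical r p :=
  ⟨mul_mem hM.1 hN, by rw [blockCoeff_mul_zero M hN, hM.2, zero_mul]⟩

/-- $N$ is divisible by $w$, so $N^j$ is divisible by $w^j$. -/
lemma blockCoeff_pow {N : Matrix (Fin p × Fin r) (Fin p × Fin r) ℂ}
    (hN : N ∈ toeplitzRadical r p) (j : ℕ) (i : Fin p) (hi : i.val < j) :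
    blockCoeff (N ^ j) i = 0 := by
  induction j generalizing i with
  | zero => omega
  | succ j ih =>
    rw [pow_succ, blockCoeff_mul _ hN.1]
    refine Finset.sum_eq_zero fun k hk => ?_
    rw [Finset.mem_Iic] at hk
    by_cases hkj : k.val < j
    · rw [ih k hkj, zero_mul]
    -- Here $j\le k\le i\le j$: the only term not covered by induction carries the factor $N_0=0$.
    · have : k = i := Fin.ext (by have := Fin.le_def.1 hk; omega)
      rw [this, sub_self, hN.2, mul_zero]

lemma pow_eq_zero_of_mem_toeplitzRadical {N : Matrix (Fin p × Fin r) (Fin p × Fin r) ℂ}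
    (hN : N ∈ toeplitzRadical r p) : N ^ p = 0 :=
  eq_of_blockCoeff_eq (pow_mem hN.1 p) (zero_mem _)
    (funext fun i => (blockCoeff_pow hN p i i.isLt).trans rfl)

/-- The block matrix `A ⊗ 1`. -/
def constBlock (p : ℕ) [NeZero p] (A : Matrix (Fin r) (Fin r) ℂ) :
    Matrix (Fin p × Fin r) (Fin p × Fin r) ℂ := toeplitz (Pi.single 0 A)

lemma constBlock_mem (A : Matrix (Fin r) (Fin r) ℂ) : constBlock p A ∈ toeplitzAlgebra r p :=
  toeplitz_mem _

lemma blockCoeff_constBlock (A : Matrix (Fin r) (Fin r) ℂ) :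
    blockCoeff (constBlock p A) = Pi.single 0 A := blockCoeff_toeplitz _

lemma blockCoeff_constBlock_mul (A : Matrix (Fin r) (Fin r) ℂ)
    {N : Matrix (Fin p × Fin r) (Fin p × Fin r) ℂ} (hN : N ∈ toeplitzAlgebra r p) (i : Fin p) :
    blockCoeff (constBlock p A * N) i = A * blockCoeff N i := by
  rw [blockCoeff_mul _ hN, blockCoeff_constBlock, Finset.sum_eq_single 0]
  · simp
  · intro k _ hk
    simp [hk]
  · simp

lemma blockCoeff_one : blockCoeff (1 : Matrix (Fin p × Fin r) (Fin p × Fin r) ℂ) =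
    Pi.single 0 1 := by
  ext i a b
  by_cases hi : i = 0
  · subst hi; simp [blockCoeff, Matrix.one_apply]
  · simp [blockCoeff, hi, Ne.symm hi]

lemma constBlock_one : constBlock p (1 : Matrix (Fin r) (Fin r) ℂ) = 1 := by
  rw [constBlock, ← blockCoeff_one, toeplitz_blockCoeff (one_mem _)]

lemma constBlock_mul (A B : Matrix (Fin r) (Fin r) ℂ) :
    constBlock p (A * B) = constBlock p A * constBlock p B := by
  refine eq_of_blockCoeff_eq (constBlock_mem _) (mul_mem (constBlock_mem _) (constBlock_mem _)) ?_
  funext i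
  rw [blockCoeff_constBlock_mul _ (constBlock_mem _), blockCoeff_constBlock,
    blockCoeff_constBlock]
  by_cases hi : i = 0
  · subst hi; simp
  · simp [hi]

lemma sub_constBlock_mem {M : Matrix (Fin p × Fin r) (Fin p × Fin r) ℂ}
    (hM : M ∈ toeplitzAlgebra r p) : M - constBlock p (blockCoeff M 0) ∈ toeplitzRadical r p :=
  ⟨sub_mem hM (constBlock_mem _), by
    rw [blockCoeff_sub, blockCoeff_constBlock, Pi.sub_apply, Pi.single_eq_same, sub_self]⟩

/-- `M ↦ ∑ i, α i * Tr (M i)`, where `M i` are the blocks of the first block row of `M`. -/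
def traceForm (α : Fin p → ℂ) : Matrix (Fin p × Fin r) (Fin p × Fin r) ℂ →ₗ[ℂ] ℂ :=
  ∑ i, α i • (Matrix.traceLinearMap (Fin r) ℂ ℂ ∘ₗ LinearMap.proj i ∘ₗ blockCoeffₗ r p)

lemma traceForm_apply (α : Fin p → ℂ) (M : Matrix (Fin p × Fin r) (Fin p × Fin r) ℂ) :
    traceForm α M = ∑ i, α i * (blockCoeff M i).trace := by
  simp only [traceForm, LinearMap.sum_apply, LinearMap.smul_apply, smul_eq_mul]
  rfl

/-- The substitution $k\mapsto i-k$ exchanges the Cauchy products for $MN$ and $NM$, up to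
$\mathrm{Tr}\,AB=\mathrm{Tr}\,BA$ in each term. -/
lemma traceForm_mul_comm (α : Fin p → ℂ) {M N : Matrix (Fin p × Fin r) (Fin p × Fin r) ℂ}
    (hM : M ∈ toeplitzAlgebra r p) (hN : N ∈ toeplitzAlgebra r p) :
    traceForm α (M * N) = traceForm α (N * M) := by
  rw [traceForm_apply, traceForm_apply]
  refine Finset.sum_congr rfl fun i _ => ?_
  rw [blockCoeff_mul _ hN, blockCoeff_mul _ hM, Matrix.trace_sum, Matrix.trace_sum]
  congr 1
  have key : ∀ k ∈ Finset.Iic i, i - k ∈ Finset.Iic i := by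
    intro k hk
    rw [Finset.mem_Iic, Fin.le_def] at *
    rw [Fin.sub_val_of_le hk]
    omega
  refine Finset.sum_nbij' (i - ·) (i - ·) key key (by simp) (by simp) ?_
  intro k _
  rw [Matrix.trace_mul_comm, sub_sub_cancel]

/-- Both extra terms of `truncLog` vanish: $j=p$ because $N^p=0$, and $j=0$ because its coefficient
is a division by zero, which is $0$ by convention. -/
lemma truncLog_eq_sum_Ico {N : Matrix (Fin p × Fin r) (Fin p × Fin r) ℂ}
    (hN : N ∈ toeplitzRadical r p) :
    truncLog N = ∑ j ∈ Finset.Ico 1 p, ((-1 : ℂ) ^ (j + 1) / (j : ℂ)) • N ^ j := by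
  rw [truncLog, Finset.sum_range_succ, pow_eq_zero_of_mem_toeplitzRadical hN, smul_zero, add_zero,
    Finset.range_eq_Ico, Finset.sum_eq_sum_Ico_succ_bot (Nat.pos_of_neZero p)]
  simp

lemma truncLog_mem_radical {N : Matrix (Fin p × Fin r) (Fin p × Fin r) ℂ}
    (hN : N ∈ toeplitzRadical r p) : truncLog N ∈ toeplitzRadical r p := by
  rw [truncLog_eq_sum_Ico hN]
  refine Submodule.sum_mem _ fun j hj => Submodule.smul_mem _ _ ?_
  obtain ⟨k, rfl⟩ := Nat.exists_eq_succ_of_ne_zero (Nat.one_le_iff_ne_zero.1 (Finset.mem_Ico.1 hj).1)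
  rw [Nat.succ_eq_add_one, pow_succ]
  exact mul_mem_toeplitzRadical (pow_mem hN.1 _) hN

lemma traceForm_truncLog_conj (α : Fin p → ℂ)
    {g g' N : Matrix (Fin p × Fin r) (Fin p × Fin r) ℂ} (h : g' * g = 1)
    (hg : g ∈ toeplitzAlgebra r p) (hg' : g' ∈ toeplitzAlgebra r p)
    (hN : N ∈ toeplitzAlgebra r p) :
    traceForm α (truncLog (g * N * g')) = traceForm α (truncLog N) := by
  rw [truncLog_conj h, traceForm_mul_comm α (mul_mem hg (truncLog_mem hN)) hg', ← mul_assoc, h,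
    one_mul]

/-- The Toeplitz matrix of a polynomial in `w`. -/
def polynomialToeplitz (p : ℕ) (P : Polynomial (Matrix (Fin r) (Fin r) ℂ)) :
    Matrix (Fin p × Fin r) (Fin p × Fin r) ℂ := toeplitz fun i => P.coeff i.val

/-- Reduction modulo $w^p$ is multiplicative. This carries the polynomial powers in `theta` to
powers of matrices. -/
lemma polynomialToeplitz_mul (P Q : Polynomial (Matrix (Fin r) (Fin r) ℂ)) :
    polynomialToeplitz p (P * Q) = polynomialToeplitz p P * polynomialToeplitz p Q := by
  refine eq_of_blockCoeff_eq (toeplitz_mem _) (mul_mem (toeplitz_mem _) (toeplitz_mem _)) ?_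
  funext i
  simp only [polynomialToeplitz]
  rw [blockCoeff_mul _ (toeplitz_mem _), blockCoeff_toeplitz, blockCoeff_toeplitz, blockCoeff_toeplitz,
    Polynomial.coeff_mul, Finset.Nat.sum_antidiagonal_eq_sum_range_succ_mk]
  symm
  refine Finset.sum_nbij Fin.val ?_ (Fin.val_injective.injOn) ?_ ?_
  · intro k hk
    have := Fin.le_def.1 (Finset.mem_Iic.1 hk)
    exact Finset.mem_range.2 (by omega)
  · intro k hk
    have hk' : k < i.val + 1 := Finset.mem_range.1 hk
    exact ⟨⟨k, by omega⟩, by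
      simp only [Finset.coe_Iic, Set.mem_Iic, Fin.le_def]; omega, rfl⟩
  · intro k hk
    rw [Fin.sub_val_of_le (Finset.mem_Iic.1 hk)]

lemma polynomialToeplitz_pow (P : Polynomial (Matrix (Fin r) (Fin r) ℂ)) (j : ℕ) :
    polynomialToeplitz p (P ^ j) = polynomialToeplitz p P ^ j := by
  induction j with
  | zero =>
    rw [pow_zero, pow_zero]
    refine eq_of_blockCoeff_eq (toeplitz_mem _) (one_mem _) ?_
    rw [polynomialToeplitz, blockCoeff_toeplitz, blockCoeff_one]
    funext i
    by_cases hi : i = 0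
    · subst hi; simp
    · simp [hi, Polynomial.coeff_one, Fin.val_eq_zero_iff]
  | succ j ih => rw [pow_succ, polynomialToeplitz_mul, ih, pow_succ]

lemma polynomialToeplitz_sum (c : Fin p → Matrix (Fin r) (Fin r) ℂ) :
    polynomialToeplitz p (∑ i ∈ Finset.Ioi (0 : Fin p), Polynomial.C (c i) * Polynomial.X ^ i.val) =
      toeplitz c - constBlock p (c 0) := by
  refine eq_of_blockCoeff_eq (toeplitz_mem _) (sub_mem (toeplitz_mem _) (constBlock_mem _)) ?_
  rw [polynomialToeplitz, blockCoeff_toeplitz, blockCoeff_sub, blockCoeff_toeplitz,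
    blockCoeff_constBlock]
  funext i
  rw [Polynomial.finsetSum_coeff]
  simp only [Polynomial.coeff_C_mul_X_pow, Fin.val_inj, Finset.sum_ite_eq, Finset.mem_Ioi,
    Pi.sub_apply]
  by_cases hi : i = 0
  · subst hi; simp
  · simp [hi, Fin.pos_iff_ne_zero]

lemma theta_eq_blockCoeff (c : Fin p → Matrix (Fin r) (Fin r) ℂ) (k : Fin p) :
    theta c k = blockCoeff (truncLog (toeplitz c - constBlock p (c 0))) k := by
  have hN : toeplitz c - constBlock p (c 0) ∈ toeplitzRadical r p := by
    have := sub_constBlock_mem (toeplitz_mem c)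
    rwa [blockCoeff_toeplitz] at this
  rw [truncLog_eq_sum_Ico hN, theta, Polynomial.finsetSum_coeff]
  change _ = blockCoeffₗ r p _ k
  rw [map_sum, Finset.sum_apply]
  refine Finset.sum_congr rfl fun j _ => ?_
  rw [Polynomial.coeff_smul, map_smul, Pi.smul_apply, ← polynomialToeplitz_sum,
    ← polynomialToeplitz_pow]
  change _ = _ • blockCoeff (toeplitz _) k
  rw [blockCoeff_toeplitz]

lemma expTraceTheta_eq (α : Fin p → ℂ) (c : Fin p → Matrix (Fin r) (Fin r) ℂ) :
    expTraceTheta α c =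
      Complex.exp (traceForm α (truncLog (toeplitz c - constBlock p (c 0)))) := by
  have hN : toeplitz c - constBlock p (c 0) ∈ toeplitzRadical r p := by
    have := sub_constBlock_mem (toeplitz_mem c)
    rwa [blockCoeff_toeplitz] at this
  rw [expTraceTheta, traceForm_apply]
  congr 1
  simp only [theta_eq_blockCoeff]
  -- The logarithm has no constant coefficient, so the index $0$ contributes nothing and $\alpha_0$
  -- plays no role here.
  refine Finset.sum_subset (Finset.subset_univ _) fun i _ hi => ?_
  have hi0 : i = 0 := by simpa using hi
  rw [hi0, (truncLog_mem_radical hN).2, Matrix.trace_zero, mul_zero]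

end ToeplitzAlgebra

/-! ### Additivity of the trace of the logarithm -/

section LogarithmicDerivative

attribute [local instance] Matrix.linftyOpNormedRing Matrix.linftyOpNormedAlgebra

variable {r p : ℕ} [NeZero p]

lemma hasDerivAt_traceForm (α : Fin p → ℂ)
    {N : ℝ → Matrix (Fin p × Fin r) (Fin p × Fin r) ℂ}
    {N' : Matrix (Fin p × Fin r) (Fin p × Fin r) ℂ} {t : ℝ} (h : HasDerivAt N N' t) :
    HasDerivAt (fun s => traceForm α (N s)) (traceForm α N') t :=
  (LinearMap.toContinuousLinearMap
    ((traceForm α).restrictScalars ℝ)).hasFDerivAt.comp_hasDerivAt t h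

/-- The noncommutative product rule gives $j+1$ terms $N^aN'N^b$ with $a+b=j$; the trace form gives
all of them the same value. -/
lemma hasDerivAt_traceForm_pow (α : Fin p → ℂ)
    {N : ℝ → Matrix (Fin p × Fin r) (Fin p × Fin r) ℂ}
    {N' : Matrix (Fin p × Fin r) (Fin p × Fin r) ℂ} {t : ℝ} (h : HasDerivAt N N' t)
    (hN : N t ∈ toeplitzAlgebra r p) (hN' : N' ∈ toeplitzAlgebra r p) (j : ℕ) :
    HasDerivAt (fun s => traceForm α (N s ^ (j + 1))) ((j + 1) * traceForm α (N t ^ j * N')) t := by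
  convert hasDerivAt_traceForm α (h.fun_pow' (j + 1)) using 1
  rw [map_sum, Finset.sum_congr rfl (g := fun _ => traceForm α (N t ^ j * N'))]
  · simp
  · intro i hi
    have hi := Finset.mem_range.1 hi
    rw [traceForm_mul_comm α (mul_mem (pow_mem hN _) hN') (pow_mem hN _), ← mul_assoc, ← pow_add]
    congr 3
    simp only [Nat.pred_eq_sub_one]
    omega

/-- Modulo commutators, the derivative of `log (1 + N)` is `(1 + N)⁻¹ N'`. -/
lemma hasDerivAt_traceForm_truncLog (α : Fin p → ℂ)
    {N : ℝ → Matrix (Fin p × Fin r) (Fin p × Fin r) ℂ}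
    {N' : Matrix (Fin p × Fin r) (Fin p × Fin r) ℂ} {t : ℝ} (h : HasDerivAt N N' t)
    (hN : N t ∈ toeplitzAlgebra r p) (hN' : N' ∈ toeplitzAlgebra r p) :
    HasDerivAt (fun s => traceForm α (truncLog (N s)))
      (traceForm α ((∑ k ∈ Finset.range p, (-N t) ^ k) * N')) t := by
  -- The zero term at $j=0$ is dropped. Keeping $j=p$ in `truncLog` makes the derivative the
  -- geometric sum with exactly $p$ terms, with no nilpotency assumed.
  have h1 : (fun s => traceForm α (truncLog (N s))) = fun s => ∑ j ∈ Finset.range p,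
      ((-1 : ℂ) ^ (j + 2) / ((j : ℂ) + 1)) * traceForm α (N s ^ (j + 1)) := by
    funext s
    simp [truncLog, Finset.sum_range_succ']
  rw [h1, Finset.sum_mul, map_sum]
  refine HasDerivAt.fun_sum fun j _ => ?_
  refine ((hasDerivAt_traceForm_pow α h hN hN' j).const_mul
    ((-1 : ℂ) ^ (j + 2) / ((j : ℂ) + 1))).congr_deriv ?_
  have hj : (j : ℂ) + 1 ≠ 0 := Nat.cast_add_one_ne_zero j
  have h2 : (-N t) ^ j = ((-1 : ℂ) ^ j) • N t ^ j := by
    rw [← neg_one_smul ℂ (N t), smul_pow]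
  rw [h2, smul_mul_assoc, map_smul, smul_eq_mul, ← mul_assoc, div_mul_cancel₀ _ hj]
  ring

lemma truncGeom_mul {N : Matrix (Fin p × Fin r) (Fin p × Fin r) ℂ}
    (hN : N ∈ toeplitzRadical r p) : (∑ k ∈ Finset.range p, (-N) ^ k) * (1 + N) = 1 := by
  have := geom_sum_mul_neg (-N) p
  rwa [pow_eq_zero_of_mem_toeplitzRadical (neg_mem hN), sub_zero, sub_neg_eq_add] at this

/-- Put $1+Q(t)=(1+N)(1+tM)$. Modulo commutators the logarithmic derivative of $1+Q(t)$ is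
$(1+Q)^{-1}(1+N)M=(1+tM)^{-1}M$, which is also that of $1+tM$. So the difference of the two traces
is constant; compare $t=0$ and $t=1$. This replaces the Baker–Campbell–Hausdorff formula. -/
lemma traceForm_truncLog_mul (α : Fin p → ℂ)
    {N M : Matrix (Fin p × Fin r) (Fin p × Fin r) ℂ}
    (hN : N ∈ toeplitzRadical r p) (hM : M ∈ toeplitzRadical r p) :
    traceForm α (truncLog ((1 + N) * (1 + M) - 1)) =
      traceForm α (truncLog N) + traceForm α (truncLog M) := by
  set Q : ℝ → Matrix (Fin p × Fin r) (Fin p × Fin r) ℂ := fun t => N + t • ((1 + N) * M) with hQ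
  have hNM : (1 + N) * M ∈ toeplitzRadical r p :=
    mul_mem_toeplitzRadical (add_mem (one_mem _) hN.1) hM
  have hsm : ∀ (t : ℝ) {X : Matrix (Fin p × Fin r) (Fin p × Fin r) ℂ},
      X ∈ toeplitzRadical r p → t • X ∈ toeplitzRadical r p := fun t X hX => by
    have := Submodule.smul_mem (toeplitzRadical r p) (t : ℂ) hX
    rwa [Complex.coe_smul] at this
  have hQr : ∀ t, Q t ∈ toeplitzRadical r p := fun t => add_mem hN (hsm t hNM)
  have hQ' : ∀ t, HasDerivAt Q ((1 + N) * M) t := fun t => by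
    have := ((hasDerivAt_id t).smul_const ((1 + N) * M)).const_add N
    rwa [one_smul] at this
  have hM' : ∀ t : ℝ, HasDerivAt (fun s : ℝ => s • M) M t := fun t => by
    have := (hasDerivAt_id t).smul_const M
    rwa [one_smul] at this
  have hd : ∀ t : ℝ, HasDerivAt (fun s => traceForm α (truncLog (Q s)) -
      traceForm α (truncLog (s • M))) 0 t := fun t => by
    refine ((hasDerivAt_traceForm_truncLog α (hQ' t) (hQr t).1 hNM.1).sub
      (hasDerivAt_traceForm_truncLog α (hM' t) (hsm t hM).1 hM.1)).congr_deriv ?_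
    have h1 := truncGeom_mul (hQr t)
    have h2 := truncGeom_mul (hsm t hM)
    have h3 : 1 + Q t = (1 + N) * (1 + t • M) := by
      rw [hQ, mul_add, mul_one, add_assoc, mul_smul_comm]
    rw [h3, ← mul_assoc] at h1
    -- Both sides are inverse to $1+tM$, one from the left and one from the right.
    have h4 : (∑ k ∈ Finset.range p, (-Q t) ^ k) * (1 + N) =
        ∑ k ∈ Finset.range p, (-(t • M)) ^ k :=
      left_inv_eq_right_inv h1 (mul_eq_one_comm.1 h2)
    rw [← mul_assoc, h4, sub_self]
  have hconst := is_const_of_deriv_eq_zero (fun t => (hd t).differentiableAt)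
    (fun t => (hd t).deriv) 1 0
  have hz : truncLog (0 : Matrix (Fin p × Fin r) (Fin p × Fin r) ℂ) = 0 := by
    rw [truncLog, Finset.sum_range_succ']
    simp
  have h1 : Q 1 = (1 + N) * (1 + M) - 1 := by
    rw [hQ]
    simp only [one_smul]
    noncomm_ring
  have h0 : Q 0 = N := by simp [hQ]
  simp only [h1, h0, one_smul, zero_smul, hz, map_zero, sub_zero] at hconst
  rw [← hconst, sub_add_cancel]

/-- A matrix given by its entries. -/
def ofEntries (ι : Type*) [Fintype ι] : (ι → ι → ℂ) →L[ℂ] Matrix ι ι ℂ :=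
  LinearMap.toContinuousLinearMap (Matrix.ofLinearEquiv ℂ).toLinearMap

lemma analyticAt_exp_traceForm_truncLog (α : Fin p → ℂ)
    (C : Matrix (Fin p × Fin r) (Fin p × Fin r) ℂ)
    (e : Fin p × Fin r → Fin p × Fin r → ℂ) :
    AnalyticAt ℂ (fun e => Complex.exp (traceForm α (truncLog (Matrix.of e - C)))) e := by
  have h1 : AnalyticAt ℂ (fun e : Fin p × Fin r → Fin p × Fin r → ℂ => Matrix.of e - C) e :=
    ((ofEntries (Fin p × Fin r)).analyticAt e).sub analyticAt_const
  have h2 : AnalyticAt ℂ (fun e : Fin p × Fin r → Fin p × Fin r → ℂ =>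
      truncLog (Matrix.of e - C)) e := by
    unfold truncLog
    exact Finset.analyticAt_fun_sum _ fun j _ => analyticAt_const.fun_smul (h1.fun_pow j)
  exact (((LinearMap.toContinuousLinearMap (traceForm α)).analyticAt _).comp h2).cexp

end LogarithmicDerivative

/-! ### The explicit formulas define homomorphisms -/

section CharacterFormulas

variable {r p : ℕ} [NeZero p]

lemma coe_mem_toeplitzAlgebra (h : jordanGroup r p) :
    (h.1 : Matrix (Fin p × Fin r) (Fin p × Fin r) ℂ) ∈ toeplitzAlgebra r p := by
  rw [← toeplitz_jordanCoeff h]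
  exact toeplitz_mem _

lemma isUnit_jordanCoeff_zero (h : jordanGroup r p) : IsUnit (jordanCoeff h.1 0) := by
  obtain ⟨g, c, hc, hg⟩ := h
  simpa only [jordanCoeff, hg, blockCoeff_toeplitz] using hc

lemma jordanCoeff_zero_of_mem_unipotentGroup (h : unipotentGroup r p) :
    jordanCoeff h.1 0 = 1 := by
  obtain ⟨g, c, hc, hg⟩ := h
  simpa only [jordanCoeff, hg, blockCoeff_toeplitz] using hc

lemma coe_sub_one_mem_radical (h : unipotentGroup r p) :
    (h.1 : Matrix (Fin p × Fin r) (Fin p × Fin r) ℂ) - 1 ∈ toeplitzRadical r p := by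
  have h1 := sub_constBlock_mem (coe_mem_toeplitzAlgebra ⟨h.1, unipotentGroup_le h.2⟩)
  have h2 : blockCoeff (h.1 : Matrix (Fin p × Fin r) (Fin p × Fin r) ℂ) 0 = 1 :=
    jordanCoeff_zero_of_mem_unipotentGroup h
  rwa [h2, constBlock_one] at h1

lemma expTraceTheta_jordanCoeff (α : Fin p → ℂ) (h : unipotentGroup r p) :
    expTraceTheta α (jordanCoeff h.1) = Complex.exp (traceForm α
      (truncLog ((h.1 : Matrix (Fin p × Fin r) (Fin p × Fin r) ℂ) - 1))) := by
  rw [expTraceTheta_eq, jordanCoeff_zero_of_mem_unipotentGroup h, constBlock_one,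
    toeplitz_jordanCoeff ⟨h.1, unipotentGroup_le h.2⟩]

/-- The character `h ↦ exp (∑ α i * Tr (θ_i h))` of the unipotent group. -/
def unipotentCharacter (α : Fin p → ℂ) : unipotentGroup r p →* ℂˣ :=
  MonoidHom.toHomUnits
    { toFun := fun h => expTraceTheta α (jordanCoeff h.1)
      map_one' := by
        rw [expTraceTheta_jordanCoeff]
        simp [truncLog, Finset.sum_range_succ']
      map_mul' := fun g h => by
        rw [expTraceTheta_jordanCoeff, expTraceTheta_jordanCoeff, expTraceTheta_jordanCoeff,
          ← Complex.exp_add, ← traceForm_truncLog_mul α (coe_sub_one_mem_radical g)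
          (coe_sub_one_mem_radical h), add_sub_cancel, add_sub_cancel]
        rfl }

lemma unipotentCharacter_apply (α : Fin p → ℂ) (h : unipotentGroup r p) :
    (unipotentCharacter α h : ℂ) = expTraceTheta α (jordanCoeff h.1) := rfl

lemma isCharacter_unipotentCharacter (α : Fin p → ℂ) :
    IsCharacter (unipotentCharacter (r := r) α) := fun _ =>
  ⟨_, analyticAt_exp_traceForm_truncLog α 1 _, Filter.Eventually.of_forall fun g =>
    (unipotentCharacter_apply α g).trans (expTraceTheta_jordanCoeff α g)⟩

/-- The matrix of `h₀⁻¹ h`. -/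
def reducedMatrix (h : GL (Fin p × Fin r) ℂ) : Matrix (Fin p × Fin r) (Fin p × Fin r) ℂ :=
  constBlock p (jordanCoeff h 0)⁻¹ * h

lemma blockCoeff_reducedMatrix (h : jordanGroup r p) :
    blockCoeff (reducedMatrix h.1) = reducedCoeff h.1 :=
  funext fun i => blockCoeff_constBlock_mul _ (coe_mem_toeplitzAlgebra h) i

lemma reducedCoeff_zero (h : jordanGroup r p) : reducedCoeff h.1 0 = 1 :=
  Matrix.nonsing_inv_mul _ ((Matrix.isUnit_iff_isUnit_det _).1 (isUnit_jordanCoeff_zero h))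

lemma reducedMatrix_mem (h : jordanGroup r p) : reducedMatrix h.1 ∈ toeplitzAlgebra r p :=
  mul_mem (constBlock_mem _) (coe_mem_toeplitzAlgebra h)

lemma reducedMatrix_sub_one_mem (h : jordanGroup r p) :
    reducedMatrix h.1 - 1 ∈ toeplitzRadical r p := by
  have := sub_constBlock_mem (reducedMatrix_mem h)
  rwa [blockCoeff_reducedMatrix, reducedCoeff_zero, constBlock_one] at this

lemma expTraceTheta_reducedCoeff (α : Fin p → ℂ) (h : jordanGroup r p) :
    expTraceTheta α (reducedCoeff h.1) =
      Complex.exp (traceForm α (truncLog (reducedMatrix h.1 - 1))) := by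
  rw [expTraceTheta_eq, reducedCoeff_zero, constBlock_one, ← blockCoeff_reducedMatrix,
    toeplitz_blockCoeff (reducedMatrix_mem h)]

lemma constBlock_inv_mul {A : Matrix (Fin r) (Fin r) ℂ} (hA : IsUnit A) :
    constBlock p A⁻¹ * constBlock p A = 1 := by
  rw [← constBlock_mul, Matrix.nonsing_inv_mul _ ((Matrix.isUnit_iff_isUnit_det _).1 hA),
    constBlock_one]

/-- $(g_0h_0)^{-1}gh=\bigl(h_0^{-1}(g_0^{-1}g)h_0\bigr)(h_0^{-1}h)$: the reduced parts multiply up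
to a conjugation, which the trace form of the logarithm ignores. -/
lemma expTraceTheta_reducedCoeff_mul (α : Fin p → ℂ) (g h : jordanGroup r p) :
    expTraceTheta α (reducedCoeff (g * h).1) =
      expTraceTheta α (reducedCoeff g.1) * expTraceTheta α (reducedCoeff h.1) := by
  have hi := constBlock_inv_mul (p := p) (isUnit_jordanCoeff_zero h)
  have hi' := mul_eq_one_comm.1 hi
  set C := constBlock p (jordanCoeff h.1 0) with hC
  set C' := constBlock p (jordanCoeff h.1 0)⁻¹ with hC'
  have hm : C' * (reducedMatrix g.1 - 1) * C ∈ toeplitzRadical r p :=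
    mul_mem_toeplitzRadical' (mul_mem_toeplitzRadical (constBlock_mem _)
      (reducedMatrix_sub_one_mem g)) (constBlock_mem _)
  have h1 : reducedMatrix (g * h).1 =
      (1 + C' * (reducedMatrix g.1 - 1) * C) * (1 + (reducedMatrix h.1 - 1)) := by
    have h2 : 1 + C' * (reducedMatrix g.1 - 1) * C = C' * reducedMatrix g.1 * C := by
      rw [mul_sub, sub_mul, mul_one, hi, add_sub_cancel]
    have h3 : reducedMatrix (g * h).1 = C' * constBlock p (jordanCoeff g.1 0)⁻¹ *
        ((g.1 : Matrix (Fin p × Fin r) (Fin p × Fin r) ℂ) * h.1) := by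
      rw [hC', ← constBlock_mul, ← Matrix.mul_inv_rev, ← jordanCoeff_zero_mul]
      rfl
    rw [h2, add_sub_cancel, h3]
    change _ = C' * (constBlock p (jordanCoeff g.1 0)⁻¹ *
      (g.1 : Matrix (Fin p × Fin r) (Fin p × Fin r) ℂ)) * C * (C' * h.1)
    calc _ = C' * constBlock p (jordanCoeff g.1 0)⁻¹ *
          (g.1 : Matrix (Fin p × Fin r) (Fin p × Fin r) ℂ) * 1 * h.1 := by noncomm_ring
      _ = _ := by rw [← hi']; noncomm_ring
  rw [expTraceTheta_reducedCoeff, expTraceTheta_reducedCoeff, expTraceTheta_reducedCoeff, h1,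
    traceForm_truncLog_mul α hm (reducedMatrix_sub_one_mem h),
    traceForm_truncLog_conj α hi' (constBlock_mem _) (constBlock_mem _)
      (reducedMatrix_sub_one_mem g).1, Complex.exp_add]

lemma logDetZero_mul (x y : UniversalCover (jordanGroup r p)) :
    logDetZero (x * y) = logDetZero x + logDetZero y := by
  simp only [logDetZero, map_mul, toAdd_mul]

lemma logDetZero_one : logDetZero (1 : UniversalCover (jordanGroup r p)) = 0 := by
  simp only [logDetZero, map_one, toAdd_one]

/-- `jordanCharacter α` as a homomorphism. -/
def jordanCharacterHom (α : Fin p → ℂ) : UniversalCover (jordanGroup r p) →* ℂˣ :=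
  MonoidHom.toHomUnits
    { toFun := jordanCharacter α
      map_one' := by
        have : reducedMatrix (1 : jordanGroup r p).1 = 1 := by
          simp [reducedMatrix, jordanCoeff_zero_one, constBlock_one]
        rw [jordanCharacter, logDetZero_one, map_one, expTraceTheta_reducedCoeff, this]
        simp [truncLog, Finset.sum_range_succ']
      map_mul' := fun x y => by
        simp only [jordanCharacter]
        rw [logDetZero_mul, map_mul, expTraceTheta_reducedCoeff_mul, mul_add, Complex.exp_add]
        ring }

lemma jordanCharacterHom_apply (α : Fin p → ℂ) (x : UniversalCover (jordanGroup r p)) :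
    (jordanCharacterHom α x : ℂ) = jordanCharacter α x := rfl

/-- The straight path stays in $J_r^\circ(p)$, so $\det h_0$ is the constant path $1$ along it. -/
lemma logDetZero_unipotentLift (h : unipotentGroup r p) : logDetZero (unipotentLift h) = 0 := by
  have h1 : UniversalCover.map detZero (unipotentLift h) = 1 := by
    change ((UniversalCover.mapPath detZero (UniversalCover.mapPath unipotentIncl
      (straightPath h)) : pathGroup ℂˣ) : UniversalCover ℂˣ) = ((1 : pathGroup ℂˣ) : _)
    congr 1
    refine Subtype.ext (ContinuousMap.ext fun t => Units.ext ?_)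
    change (jordanCoeff ((straightPath h).1 t).1 0).det = 1
    rw [jordanCoeff_zero_of_mem_unipotentGroup, Matrix.det_one]
  rw [logDetZero, h1, map_one, toAdd_one]

lemma jordanCharacter_unipotentLift (α : Fin p → ℂ) (h : unipotentGroup r p) :
    jordanCharacter α (unipotentLift h) = expTraceTheta α (jordanCoeff h.1) := by
  have h1 : (UniversalCover.proj (unipotentLift h) : jordanGroup r p).1 = h.1 :=
    congrArg Subtype.val (straightPath_one h)
  have h2 : reducedCoeff h.1 = jordanCoeff h.1 := by
    funext i
    rw [reducedCoeff, jordanCoeff_zero_of_mem_unipotentGroup, inv_one, one_mul]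
  rw [jordanCharacter, logDetZero_unipotentLift, mul_zero, Complex.exp_zero, one_mul, h1, h2]

end CharacterFormulas

/-! ### Straight paths near the identity and homomorphisms with zero differential -/

section StraightPaths

variable {r p : ℕ} [NeZero p]

/-- An invertible block Toeplitz matrix, as an element of `J_r(p)`. -/
def jordanOf (M : Matrix (Fin p × Fin r) (Fin p × Fin r) ℂ) (hM : M ∈ toeplitzAlgebra r p)
    (hd : M.det ≠ 0) : jordanGroup r p :=
  ⟨Matrix.GeneralLinearGroup.mkOfDetNeZero M hd, blockCoeff M, by
    refine IsUnit.of_mul_eq_one (blockCoeff M⁻¹ 0) (mul_eq_one_comm.1 ?_)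
    rw [← blockCoeff_mul_zero _ hM, Matrix.nonsing_inv_mul _ (isUnit_iff_ne_zero.2 hd),
      blockCoeff_one, Pi.single_eq_same], (toeplitz_blockCoeff hM).symm⟩

lemma jordanOf_val (M : Matrix (Fin p × Fin r) (Fin p × Fin r) ℂ) (hM : M ∈ toeplitzAlgebra r p)
    (hd : M.det ≠ 0) :
    ((jordanOf M hM hd).1 : Matrix (Fin p × Fin r) (Fin p × Fin r) ℂ) = M := rfl

lemma jordanGroup_ext {g h : jordanGroup r p}
    (H : (g.1 : Matrix (Fin p × Fin r) (Fin p × Fin r) ℂ) = h.1) : g = h :=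
  Subtype.ext (Units.ext H)

lemma continuous_coe_jordanGroup : Continuous fun g : jordanGroup r p =>
    (g.1 : Matrix (Fin p × Fin r) (Fin p × Fin r) ℂ) :=
  Units.continuous_val.comp continuous_subtype_val

lemma continuous_jordanOf {X : Type*} [TopologicalSpace X]
    {M : X → Matrix (Fin p × Fin r) (Fin p × Fin r) ℂ} (hc : Continuous M)
    (hM : ∀ x, M x ∈ toeplitzAlgebra r p) (hd : ∀ x, (M x).det ≠ 0) :
    Continuous fun x => jordanOf (M x) (hM x) (hd x) := by
  refine Continuous.subtype_mk ?_ _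
  rw [Units.continuous_iff]
  refine ⟨hc, ?_⟩
  have : Continuous fun x => (M x)⁻¹ := by
    simp only [Matrix.inv_def, Ring.inverse_eq_inv']
    exact (hc.matrix_det.inv₀ hd).smul hc.matrix_adjugate
  convert this using 2 with x
  exact Matrix.coe_units_inv _

/-- The matrix `1 + s (g - 1)`. -/
def segmentMatrix (s : ℂ) (g : jordanGroup r p) : Matrix (Fin p × Fin r) (Fin p × Fin r) ℂ :=
  1 + s • ((g.1 : Matrix (Fin p × Fin r) (Fin p × Fin r) ℂ) - 1)

lemma segmentMatrix_mem (s : ℂ) (g : jordanGroup r p) :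
    segmentMatrix s g ∈ toeplitzAlgebra r p :=
  add_mem (one_mem _) (Subalgebra.smul_mem _ (sub_mem (coe_mem_toeplitzAlgebra g) (one_mem _)) _)

variable (r p) in
/-- The elements `g` of `J_r(p)` such that the segment from `1` to `g` is contained in `J_r(p)`. -/
def starDomain : Set (jordanGroup r p) := {g | ∀ s : I, (segmentMatrix ((s : ℝ) : ℂ) g).det ≠ 0}

lemma one_mem_starDomain : 1 ∈ starDomain r p := fun s => by simp [segmentMatrix]

instance : One (starDomain r p) := ⟨⟨1, one_mem_starDomain⟩⟩

lemma continuous_segmentMatrix :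
    Continuous fun x : I × jordanGroup r p => segmentMatrix ((x.1 : ℝ) : ℂ) x.2 := by
  have h1 := (continuous_coe_jordanGroup (r := r) (p := p)).comp
    (continuous_snd : Continuous (Prod.snd : I × jordanGroup r p → _))
  have h2 : Continuous fun x : I × jordanGroup r p => (((x.1 : I) : ℝ) : ℂ) := by fun_prop
  exact continuous_const.add (h2.smul (h1.sub continuous_const))

/-- A tube argument: the determinant is nonzero at $g=1$ for each $s$, and `I` is compact. -/
lemma starDomain_mem_nhds : starDomain r p ∈ 𝓝 1 := by
  have := (isCompact_univ (X := I)).eventually_forall_of_forall_eventually (x₀ := (1 : jordanGroup r p))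
    (P := fun g s => (segmentMatrix ((s : ℝ) : ℂ) g).det ≠ 0) (fun s _ => by
      have hc : Continuous fun x : jordanGroup r p × I =>
          (segmentMatrix ((x.2 : ℝ) : ℂ) x.1).det :=
        (continuous_segmentMatrix.comp continuous_swap).matrix_det
      exact hc.continuousAt.eventually_ne (one_mem_starDomain s))
  filter_upwards [this] with g hg s using hg s (Set.mem_univ s)

/-- The element `1 + s (g - 1)` of `J_r(p)`. -/
def segmentPoint (x : starDomain r p × I) : jordanGroup r p :=
  jordanOf (segmentMatrix ((x.2 : ℝ) : ℂ) x.1.1) (segmentMatrix_mem _ _) (x.1.2 x.2)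

lemma continuous_segmentPoint : Continuous (segmentPoint (r := r) (p := p)) :=
  continuous_jordanOf (continuous_segmentMatrix.comp
    (continuous_snd.prodMk (continuous_subtype_val.comp continuous_fst))) _ _

lemma segmentPoint_val (x : starDomain r p × I) :
    ((segmentPoint x).1 : Matrix (Fin p × Fin r) (Fin p × Fin r) ℂ) =
      1 + ((x.2 : ℝ) : ℂ) • ((x.1.1.1 : Matrix (Fin p × Fin r) (Fin p × Fin r) ℂ) - 1) := rfl

lemma segmentPoint_zero (g : starDomain r p) : segmentPoint (g, 0) = 1 :=
  jordanGroup_ext (by rw [segmentPoint_val]; simp)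

lemma segmentPoint_one (g : starDomain r p) : segmentPoint (g, 1) = g.1 :=
  jordanGroup_ext (by rw [segmentPoint_val]; simp)

lemma segmentPoint_mem_starDomain (x : starDomain r p × I) : segmentPoint x ∈ starDomain r p := by
  intro s
  convert x.1.2 (s * x.2) using 2
  simp only [segmentMatrix, segmentPoint_val, add_sub_cancel_left, smul_smul]
  simp

/-- The class of the straight path from `1` to `g`. -/
def straightLift (g : starDomain r p) : UniversalCover (jordanGroup r p) :=
  ((⟨ContinuousMap.curry ⟨segmentPoint, continuous_segmentPoint⟩ g, segmentPoint_zero g⟩ :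
    pathGroup (jordanGroup r p)) : UniversalCover (jordanGroup r p))

/-- Together with `proj_straightLift`, this provides a continuous section of the projection over a
neighbourhood of $1$. -/
lemma continuous_straightLift : Continuous (straightLift (r := r) (p := p)) :=
  continuous_quot_mk.comp ((ContinuousMap.continuous _).subtype_mk _)

lemma proj_straightLift (g : starDomain r p) :
    UniversalCover.proj (straightLift g) = g.1 := segmentPoint_one g

lemma straightLift_one : straightLift (1 : starDomain r p) = 1 := by
  change _ = ((1 : pathGroup (jordanGroup r p)) : UniversalCover (jordanGroup r p))
  rw [straightLift]
  congr 1
  refine Subtype.ext (ContinuousMap.ext fun t => jordanGroup_ext ?_)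
  change ((segmentPoint ((1 : starDomain r p), t)).1 : Matrix (Fin p × Fin r) (Fin p × Fin r) ℂ) = 1
  rw [segmentPoint_val]
  change 1 + _ • (1 - 1 : Matrix (Fin p × Fin r) (Fin p × Fin r) ℂ) = 1
  simp

/-- The segment from `1` to `g`, as a path in the star domain. -/
def segmentPath (g : starDomain r p) (t : I) : starDomain r p :=
  ⟨segmentPoint (g, t), segmentPoint_mem_starDomain _⟩

lemma continuous_segmentPath (g : starDomain r p) : Continuous (segmentPath g) :=
  (continuous_segmentPoint.comp (continuous_const.prodMk continuous_id)).subtype_mk _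

lemma segmentPath_val (g : starDomain r p) (t : I) :
    ((segmentPath g t).1.1 : Matrix (Fin p × Fin r) (Fin p × Fin r) ℂ) =
      1 + ((t : ℝ) : ℂ) • ((g.1.1 : Matrix (Fin p × Fin r) (Fin p × Fin r) ℂ) - 1) := rfl

lemma segmentPath_zero (g : starDomain r p) : segmentPath g 0 = 1 := Subtype.ext (segmentPoint_zero g)

lemma segmentPath_one (g : starDomain r p) : segmentPath g 1 = g := Subtype.ext (segmentPoint_one g)

/-- A homomorphism which near `1` is a function of the matrix entries with vanishing derivative
at `1` is trivial. -/
lemma eq_one_of_hasDerivAt (ψ : UniversalCover (jordanGroup r p) →* ℂˣ)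
    (F : Matrix (Fin p × Fin r) (Fin p × Fin r) ℂ → ℂ)
    (hF : ∀ᶠ x in 𝓝 1, (ψ x : ℂ) = F (UniversalCover.proj x).1)
    (hd : ∀ Y ∈ toeplitzAlgebra r p, HasDerivAt (fun ε : ℝ => F (1 + (ε : ℂ) • Y)) 0 0)
    (x : UniversalCover (jordanGroup r p)) : ψ x = 1 := by
  have key : ∀ g : starDomain r p, ψ (straightLift g) = 1 := by
    intro g
    -- The lift of the segment from $1$ to $g$, frozen outside $[0,1]$ so that it is defined on
    -- $\mathbb R$.
    set c : ℝ → UniversalCover (jordanGroup r p) := fun t =>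
      straightLift (segmentPath g (Set.projIcc 0 1 zero_le_one t)) with hc
    have hcc : Continuous c := continuous_straightLift.comp
      ((continuous_segmentPath g).comp continuous_projIcc)
    set φ : ℝ → ℂ := fun t => ψ (c t) with hφ
    set X := (g.1.1 : Matrix (Fin p × Fin r) (Fin p × Fin r) ℂ) - 1 with hX
    have hXm : X ∈ toeplitzAlgebra r p := sub_mem (coe_mem_toeplitzAlgebra g.1) (one_mem _)
    have hder : ∀ t ∈ Set.Icc (0 : ℝ) 1, HasDerivWithinAt φ 0 (Set.Icc 0 1) t := by
      intro t ht
      set a : jordanGroup r p := (UniversalCover.proj (c t))⁻¹ with ha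
      set Y := (a.1 : Matrix (Fin p × Fin r) (Fin p × Fin r) ℂ) * X with hY
      have hYm : Y ∈ toeplitzAlgebra r p := mul_mem (coe_mem_toeplitzAlgebra a) hXm
      -- Translation to the identity: $\psi(c_u)=\psi(c_t)\psi(c_t^{-1}c_u)$, and $c_t^{-1}c_u$ lies
      -- over $1+(u-t)Y$ with $Y=(1+tX)^{-1}X$, a direction in which `F` has zero derivative.
      have h1 : HasDerivAt (fun u : ℝ => φ t * F (1 + ((u - t : ℝ) : ℂ) • Y)) 0 t := by
        have h2 := hd Y hYm
        rw [← sub_self t] at h2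
        simpa using (h2.comp_sub_const t t).const_mul (φ t)
      refine h1.hasDerivWithinAt.congr_of_eventuallyEq_of_mem ?_ ht
      have h3 : Filter.Tendsto (fun u => (c t)⁻¹ * c u) (𝓝 t) (𝓝 1) := by
        have h4 : Continuous fun u => (c t)⁻¹ * c u := continuous_const.mul hcc
        have := h4.tendsto t
        rwa [inv_mul_cancel] at this
      filter_upwards [(h3.eventually hF).filter_mono nhdsWithin_le_nhds, self_mem_nhdsWithin]
        with u hu huI
      have h4 : φ u = φ t * ψ ((c t)⁻¹ * c u) := by
        rw [map_mul, map_inv, ← Units.val_mul, mul_inv_cancel_left]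
      rw [h4, hu]
      congr 2
      have hval : ∀ v ∈ Set.Icc (0 : ℝ) 1, ((UniversalCover.proj (c v)).1 :
          Matrix (Fin p × Fin r) (Fin p × Fin r) ℂ) = 1 + (v : ℂ) • X := by
        intro v hv
        rw [hc]
        simp only [proj_straightLift, segmentPath_val, Set.projIcc_of_mem zero_le_one hv, hX]
      have h5 : (a.1 : Matrix (Fin p × Fin r) (Fin p × Fin r) ℂ) * (1 + (t : ℂ) • X) = 1 := by
        rw [← hval t ht, ha, ← Units.val_mul]
        simp
      rw [map_mul, map_inv, ← ha]
      change (a.1 : Matrix (Fin p × Fin r) (Fin p × Fin r) ℂ) * (UniversalCover.proj (c u)).1 = _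
      rw [hval u huI]
      have h6 : (1 : Matrix (Fin p × Fin r) (Fin p × Fin r) ℂ) + (u : ℂ) • X =
          (1 + (t : ℂ) • X) + ((u - t : ℝ) : ℂ) • X := by
        rw [add_assoc, ← add_smul]
        simp
      rw [h6, mul_add, h5, mul_smul_comm]
    have h0 : φ 0 = 1 := by
      simp only [hφ, hc, Set.projIcc_left]
      change ((ψ (straightLift (segmentPath g 0)) : ℂˣ) : ℂ) = 1
      rw [segmentPath_zero, straightLift_one, map_one, Units.val_one]
    have h1 := constant_of_derivWithin_zero (fun t ht => (hder t ht).differentiableWithinAt)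
      (fun t ht => (hder t (Set.Ico_subset_Icc_self ht)).derivWithin
        (uniqueDiffOn_Icc zero_lt_one t (Set.Ico_subset_Icc_self ht))) 1 ⟨zero_le_one, le_rfl⟩
    rw [h0] at h1
    simp only [hφ, hc, Set.projIcc_right] at h1
    change ((ψ (straightLift (segmentPath g 1)) : ℂˣ) : ℂ) = 1 at h1
    rw [segmentPath_one] at h1
    exact Units.ext h1
  -- `key` only concerns the points `straightLift g`. It gives `F` the value $1$ at all matrices of
  -- the group near $1$; since `ψ` factors through `F` near $1$, it is trivial on a full
  -- neighbourhood.
  refine UniversalCover.eq_one_of_eventually ψ ?_ x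
  have h1 : ∀ᶠ g : starDomain r p in 𝓝 1,
      F (g.1.1 : Matrix (Fin p × Fin r) (Fin p × Fin r) ℂ) = 1 := by
    have h2 : Filter.Tendsto (straightLift (r := r) (p := p)) (𝓝 1) (𝓝 1) := by
      have := (continuous_straightLift (r := r) (p := p)).tendsto 1
      rwa [straightLift_one] at this
    filter_upwards [h2.eventually hF] with g hg
    rw [proj_straightLift, key g] at hg
    exact hg.symm
  have h3 : ∀ᶠ g : jordanGroup r p in 𝓝 1,
      F (g.1 : Matrix (Fin p × Fin r) (Fin p × Fin r) ℂ) = 1 := by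
    have : Filter.map ((↑) : starDomain r p → jordanGroup r p) (𝓝 1) = 𝓝 1 :=
      map_nhds_subtype_coe_eq_nhds one_mem_starDomain starDomain_mem_nhds
    rw [← this]
    exact h1
  have h4 : Filter.Tendsto (UniversalCover.proj (G := jordanGroup r p)) (𝓝 1) (𝓝 1) := by
    have := (UniversalCover.continuous_proj (G := jordanGroup r p)).tendsto 1
    rwa [map_one] at this
  filter_upwards [hF, h4.eventually h3] with y hy hy'
  exact Units.ext (by rw [hy, hy', Units.val_one])

end StraightPaths

/-! ### The differential of a character is a trace form -/

/-- A linear form on square matrices which is invariant under cyclic permutations is a multiple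
of the trace. -/
lemma Matrix.exists_eq_mul_trace {n : Type*} [Fintype n] [DecidableEq n]
    (f : Matrix n n ℂ →ₗ[ℂ] ℂ) (hf : ∀ A B, f (A * B) = f (B * A)) :
    ∃ a : ℂ, ∀ A, f A = a * A.trace := by
  rcases isEmpty_or_nonempty n with hn | ⟨⟨k⟩⟩
  · exact ⟨0, fun A => by rw [Subsingleton.elim A 0]; simp⟩
  refine ⟨f (Matrix.single k k 1), fun A => ?_⟩
  -- $E_{ii}E_{ij}=E_{ij}$ whereas $E_{ij}E_{ii}=0$.
  have h1 : ∀ i j, i ≠ j → f (Matrix.single i j 1) = 0 := by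
    intro i j hij
    have := hf (Matrix.single i i 1) (Matrix.single i j 1)
    rwa [Matrix.single_mul_single_same, Matrix.single_mul_single_of_ne _ _ _ _ hij.symm,
      map_zero, mul_one] at this
  have h2 : ∀ i, f (Matrix.single i i 1) = f (Matrix.single k k 1) := by
    intro i
    have := hf (Matrix.single i k 1) (Matrix.single k i 1)
    rwa [Matrix.single_mul_single_same, Matrix.single_mul_single_same, mul_one] at this
  have h3 : ∀ i j, f (Matrix.single i j (A i j)) =
      if i = j then f (Matrix.single k k 1) * A i i else 0 := by
    intro i j
    have : Matrix.single i j (A i j) = A i j • Matrix.single i j (1 : ℂ) := by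
      rw [Matrix.smul_single, smul_eq_mul, mul_one]
    rw [this, map_smul, smul_eq_mul]
    split_ifs with h
    · subst h; rw [h2, mul_comm]
    · rw [h1 i j h, mul_zero]
  conv_lhs => rw [Matrix.matrix_eq_sum_single A]
  simp only [map_sum, h3, Finset.sum_ite_eq, Finset.mem_univ, if_true, Matrix.trace,
    Matrix.diag_apply, Finset.mul_sum]

section Differential

variable {r p : ℕ} [NeZero p]

/-- Any small nonzero $\delta$ works, by compactness of `I`. Identities proved for group elements
can thus be transferred to arbitrary elements of the algebra. -/
lemma exists_mem_starDomain {X : Matrix (Fin p × Fin r) (Fin p × Fin r) ℂ}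
    (hX : X ∈ toeplitzAlgebra r p) : ∃ δ : ℂ, δ ≠ 0 ∧ ∃ g : starDomain r p,
      (g.1.1 : Matrix (Fin p × Fin r) (Fin p × Fin r) ℂ) = 1 + δ • X := by
  have h1 := (isCompact_univ (X := I)).eventually_forall_of_forall_eventually (x₀ := (0 : ℂ))
    (P := fun δ s => (1 + (((s : ℝ) : ℂ) * δ) • X).det ≠ 0) (fun s _ => by
      have hc : Continuous fun x : ℂ × I => (1 + (((x.2 : ℝ) : ℂ) * x.1) • X).det := by
        have hs : Continuous fun x : ℂ × I => ((x.2 : ℝ) : ℂ) * x.1 := by fun_prop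
        exact (continuous_const.add (hs.smul continuous_const)).matrix_det
      exact hc.continuousAt.eventually_ne (by simp))
  have h2 : ∀ᶠ δ : ℂ in 𝓝[≠] 0, ∀ s ∈ (Set.univ : Set I),
      (1 + (((s : ℝ) : ℂ) * δ) • X).det ≠ 0 := h1.filter_mono nhdsWithin_le_nhds
  obtain ⟨δ, hδ, hδ0⟩ := (h2.and self_mem_nhdsWithin).exists
  have hd : (1 + δ • X).det ≠ 0 := by simpa using hδ 1 (Set.mem_univ _)
  refine ⟨δ, hδ0, ⟨jordanOf (1 + δ • X) (add_mem (one_mem _) (Subalgebra.smul_mem _ hX _)) hd,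
    fun s => ?_⟩, rfl⟩
  convert hδ s (Set.mem_univ _) using 2
  rw [segmentMatrix, jordanOf_val, add_sub_cancel_left, smul_smul]

variable {χ : UniversalCover (jordanGroup r p) →* ℂˣ}
  {F : Matrix (Fin p × Fin r) (Fin p × Fin r) ℂ → ℂ}
  {L : Matrix (Fin p × Fin r) (Fin p × Fin r) ℂ →ₗ[ℂ] ℂ}

/-- A curve and its conjugate in the cover have the same image under the character, the target being
commutative; their projections leave $1$ in the directions $X$ and $gXg^{-1}$. -/
lemma differential_conj
    (hF : ∀ᶠ x in 𝓝 1, (χ x : ℂ) = F (UniversalCover.proj x).1)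
    (hL : ∀ Y ∈ toeplitzAlgebra r p, HasDerivAt (fun ε : ℝ => F (1 + (ε : ℂ) • Y)) (L Y) 0)
    (g h : starDomain r p) :
    L ((g.1.1 : Matrix (Fin p × Fin r) (Fin p × Fin r) ℂ) *
      ((h.1.1 : Matrix (Fin p × Fin r) (Fin p × Fin r) ℂ) - 1) * (g.1⁻¹).1) =
      L ((h.1.1 : Matrix (Fin p × Fin r) (Fin p × Fin r) ℂ) - 1) := by
  set X := (h.1.1 : Matrix (Fin p × Fin r) (Fin p × Fin r) ℂ) - 1 with hX
  have hXm : X ∈ toeplitzAlgebra r p := sub_mem (coe_mem_toeplitzAlgebra h.1) (one_mem _)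
  set X' := (g.1.1 : Matrix (Fin p × Fin r) (Fin p × Fin r) ℂ) * X * (g.1⁻¹).1 with hX'
  have hXm' : X' ∈ toeplitzAlgebra r p :=
    mul_mem (mul_mem (coe_mem_toeplitzAlgebra g.1) hXm) (coe_mem_toeplitzAlgebra g.1⁻¹)
  set c : ℝ → UniversalCover (jordanGroup r p) := fun t =>
    straightLift (segmentPath h (Set.projIcc 0 1 zero_le_one t)) with hc
  have hcc : Continuous c := continuous_straightLift.comp
    ((continuous_segmentPath h).comp continuous_projIcc)
  have hc0 : c 0 = 1 := by
    simp only [hc, Set.projIcc_left]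
    change straightLift (segmentPath h 0) = 1
    rw [segmentPath_zero, straightLift_one]
  have hval : ∀ v ∈ Set.Icc (0 : ℝ) 1, ((UniversalCover.proj (c v)).1 :
      Matrix (Fin p × Fin r) (Fin p × Fin r) ℂ) = 1 + (v : ℂ) • X := by
    intro v hv
    rw [hc]
    simp only [proj_straightLift, segmentPath_val, Set.projIcc_of_mem zero_le_one hv, hX]
  set k : UniversalCover (jordanGroup r p) := straightLift g with hk
  have h1 : Filter.Tendsto c (𝓝 0) (𝓝 1) := by
    have := hcc.tendsto 0
    rwa [hc0] at this
  have h2 : Filter.Tendsto (fun t => k * c t * k⁻¹) (𝓝 0) (𝓝 1) := by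
    have h3 : Continuous fun t => k * c t * k⁻¹ :=
      (continuous_const.mul hcc).mul continuous_const
    have := h3.tendsto 0
    rwa [hc0, mul_one, mul_inv_cancel] at this
  -- The lifted segment only gives information for $t\ge0$; one-sided derivatives at $0$ suffice.
  have h3 : (fun t : ℝ => F (1 + (t : ℂ) • X')) =ᶠ[𝓝[Set.Icc 0 1] 0]
      fun t : ℝ => F (1 + (t : ℂ) • X) := by
    filter_upwards [(h1.eventually hF).filter_mono nhdsWithin_le_nhds,
      (h2.eventually hF).filter_mono nhdsWithin_le_nhds, self_mem_nhdsWithin] with t ht ht' htI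
    have h4 : ((UniversalCover.proj (k * c t * k⁻¹)).1 :
        Matrix (Fin p × Fin r) (Fin p × Fin r) ℂ) = 1 + (t : ℂ) • X' := by
      rw [map_mul, map_mul, map_inv, hk, proj_straightLift]
      change (g.1.1 : Matrix (Fin p × Fin r) (Fin p × Fin r) ℂ) * (UniversalCover.proj (c t)).1 *
        (g.1⁻¹).1 = _
      have h5 : (g.1.1 : Matrix (Fin p × Fin r) (Fin p × Fin r) ℂ) * (g.1⁻¹).1 = 1 :=
        Units.mul_inv g.1.1
      rw [hval t htI, mul_add, add_mul, mul_one, h5, mul_smul_comm, smul_mul_assoc]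
    rw [← h4, ← hval t htI, ← ht, ← ht', map_mul, map_mul, map_inv, mul_right_comm,
      mul_inv_cancel, one_mul]
  have h0 : (0 : ℝ) ∈ Set.Icc (0 : ℝ) 1 := ⟨le_rfl, zero_le_one⟩
  exact (uniqueDiffOn_Icc zero_lt_one 0 h0).eq_deriv _
    ((hL X' hXm').hasDerivWithinAt)
    ((hL X hXm).hasDerivWithinAt.congr_of_eventuallyEq_of_mem h3 h0)

/-- With $g=1+\delta A$ and $h=1+\varepsilon Bg$, conjugation invariance reads $L(gB)=L(Bg)$, and
the part linear in $\delta$ is the claim. -/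
lemma differential_mul_comm
    (hF : ∀ᶠ x in 𝓝 1, (χ x : ℂ) = F (UniversalCover.proj x).1)
    (hL : ∀ Y ∈ toeplitzAlgebra r p, HasDerivAt (fun ε : ℝ => F (1 + (ε : ℂ) • Y)) (L Y) 0)
    {A B : Matrix (Fin p × Fin r) (Fin p × Fin r) ℂ}
    (hA : A ∈ toeplitzAlgebra r p) (hB : B ∈ toeplitzAlgebra r p) : L (A * B) = L (B * A) := by
  obtain ⟨δ, hδ, g, hg⟩ := exists_mem_starDomain hA
  have hBg : B * (g.1.1 : Matrix (Fin p × Fin r) (Fin p × Fin r) ℂ) ∈ toeplitzAlgebra r p :=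
    mul_mem hB (coe_mem_toeplitzAlgebra g.1)
  obtain ⟨ε, hε, h, hh⟩ := exists_mem_starDomain hBg
  have key := differential_conj hF hL g h
  have h5 : (g.1.1 : Matrix (Fin p × Fin r) (Fin p × Fin r) ℂ) * (g.1⁻¹).1 = 1 :=
    Units.mul_inv g.1.1
  rw [hh, add_sub_cancel_left, mul_smul_comm, smul_mul_assoc, map_smul, map_smul, mul_assoc,
    mul_assoc, h5, mul_one, hg, add_mul, mul_add, one_mul, mul_one, map_add, map_add,
    smul_mul_assoc, mul_smul_comm, map_smul, map_smul] at key
  exact smul_right_injective ℂ hδ (add_left_cancel (smul_right_injective ℂ hε key))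

/-- The matrix `A ⊗ Λ ^ i`, as a linear function of `A`. -/
def shiftBlock (i : Fin p) :
    Matrix (Fin r) (Fin r) ℂ →ₗ[ℂ] Matrix (Fin p × Fin r) (Fin p × Fin r) ℂ where
  toFun A := toeplitz (Pi.single i A)
  map_add' A B := eq_of_blockCoeff_eq (toeplitz_mem _) (add_mem (toeplitz_mem _) (toeplitz_mem _))
    (by rw [blockCoeff_add, blockCoeff_toeplitz, blockCoeff_toeplitz, blockCoeff_toeplitz,
      Pi.single_add])
  map_smul' a A := eq_of_blockCoeff_eq (toeplitz_mem _)
    (Subalgebra.smul_mem _ (toeplitz_mem _) _)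
    (by
      rw [RingHom.id_apply, blockCoeff_smul, blockCoeff_toeplitz, blockCoeff_toeplitz,
        Pi.single_smul])

lemma blockCoeff_shiftBlock (i : Fin p) (A : Matrix (Fin r) (Fin r) ℂ) :
    blockCoeff (shiftBlock i A) = Pi.single i A := blockCoeff_toeplitz _

lemma shiftBlock_mem (i : Fin p) (A : Matrix (Fin r) (Fin r) ℂ) :
    shiftBlock i A ∈ toeplitzAlgebra r p := toeplitz_mem _

lemma constBlock_mul_shiftBlock (i : Fin p) (A B : Matrix (Fin r) (Fin r) ℂ) :
    constBlock p A * shiftBlock i B = shiftBlock i (A * B) := by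
  refine eq_of_blockCoeff_eq (mul_mem (constBlock_mem _) (shiftBlock_mem _ _))
    (shiftBlock_mem _ _) (funext fun j => ?_)
  rw [blockCoeff_constBlock_mul _ (shiftBlock_mem _ _), blockCoeff_shiftBlock,
    blockCoeff_shiftBlock]
  by_cases hj : j = i
  · subst hj; simp
  · simp [hj]

lemma shiftBlock_mul_constBlock (i : Fin p) (A B : Matrix (Fin r) (Fin r) ℂ) :
    shiftBlock i A * constBlock p B = shiftBlock i (A * B) := by
  refine eq_of_blockCoeff_eq (mul_mem (shiftBlock_mem _ _) (constBlock_mem _))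
    (shiftBlock_mem _ _) (funext fun j => ?_)
  rw [blockCoeff_mul _ (constBlock_mem _), blockCoeff_shiftBlock, blockCoeff_shiftBlock,
    blockCoeff_constBlock, Finset.sum_eq_single j]
  · by_cases hj : j = i
    · subst hj; simp
    · simp [hj]
  · intro k _ hk
    rw [Pi.single_eq_of_ne (sub_ne_zero.2 hk.symm), mul_zero]
  · simp

lemma sum_shiftBlock {M : Matrix (Fin p × Fin r) (Fin p × Fin r) ℂ}
    (hM : M ∈ toeplitzAlgebra r p) : ∑ i, shiftBlock i (blockCoeff M i) = M := by
  refine eq_of_blockCoeff_eq (Subalgebra.sum_mem _ fun i _ => shiftBlock_mem _ _) hM ?_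
  change blockCoeffₗ r p _ = _
  rw [map_sum]
  change ∑ i, blockCoeff (shiftBlock i (blockCoeff M i)) = _
  simp only [blockCoeff_shiftBlock, Finset.univ_sum_single]

/-- A linear form on the block Toeplitz matrices which is invariant under cyclic permutations is
of the form `M ↦ ∑ i, α i * Tr (M i)`. -/
lemma exists_eq_traceForm
    (hL : ∀ A ∈ toeplitzAlgebra r p, ∀ B ∈ toeplitzAlgebra r p, L (A * B) = L (B * A)) :
    ∃ α : Fin p → ℂ, ∀ M ∈ toeplitzAlgebra r p, L M = traceForm α M := by
  -- $AB\otimes\Lambda^i=(A\otimes1)(B\otimes\Lambda^i)$, and exchanging the two factors gives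
  -- $BA\otimes\Lambda^i$.
  have h : ∀ i : Fin p, ∃ a : ℂ, ∀ A, (L ∘ₗ shiftBlock i) A = a * A.trace := fun i =>
    Matrix.exists_eq_mul_trace _ fun A B => by
      rw [LinearMap.comp_apply, LinearMap.comp_apply, ← constBlock_mul_shiftBlock,
        ← shiftBlock_mul_constBlock, hL _ (constBlock_mem _) _ (shiftBlock_mem _ _)]
  choose α hα using h
  refine ⟨α, fun M hM => ?_⟩
  conv_lhs => rw [← sum_shiftBlock hM]
  rw [map_sum, traceForm_apply]
  exact Finset.sum_congr rfl fun i _ => hα i _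

end Differential

/-! ### Differential of `jordanCharacter` and classification of the characters -/

section JordanCharacters

variable {r p : ℕ} [NeZero p]

lemma hasDerivAt_det_one_add_smul (Y : Matrix (Fin r) (Fin r) ℂ) :
    HasDerivAt (fun z : ℂ => (1 + z • Y).det) Y.trace 0 := by
  rw [funext fun z : ℂ => Matrix.det_one_add_smul z Y]
  -- The remainder in $\det(1+zY)=1+z\,\mathrm{Tr}\,Y+z^2q(z)$.
  set q := (1 + (Polynomial.X : Polynomial ℂ) • Y.map Polynomial.C).det.divX.divX
  have h1 := ((hasDerivAt_id (0 : ℂ)).const_mul Y.trace).const_add 1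
  have h2 := (q.hasDerivAt 0).mul ((hasDerivAt_id (0 : ℂ)).pow 2)
  refine (h1.add h2).congr_deriv ?_
  simp

/-- The difference quotient at $0$ is $K$ itself. This avoids differentiating a matrix inverse
below. -/
lemma hasDerivAt_smul_of_continuousAt {E : Type*} [NormedAddCommGroup E] [NormedSpace ℝ E]
    {K : ℝ → E} (hK : ContinuousAt K 0) : HasDerivAt (fun t => t • K t) (K 0) 0 := by
  rw [hasDerivAt_iff_tendsto_slope_zero]
  refine (hK.tendsto.mono_left nhdsWithin_le_nhds).congr' ?_
  filter_upwards [self_mem_nhdsWithin] with t ht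
  have ht : t ≠ 0 := ht
  simp [smul_smul, ht]

lemma continuous_constBlock : Continuous (constBlock (r := r) p) :=
  (shiftBlock (r := r) (0 : Fin p)).continuous_of_finiteDimensional

section

attribute [local instance] Matrix.linftyOpNormedRing Matrix.linftyOpNormedAlgebra

/-- For small $\varepsilon$ the argument of the logarithm is $\varepsilon K(\varepsilon)$ with
$K(\varepsilon)=(1+\varepsilon Y_0)^{-1}(Y-Y_0)$, constants being read as $A\otimes1$. $K$ is
continuous at $0$, so the derivative there is $K(0)$. -/
lemma hasDerivAt_truncLog_reduced (α : Fin p → ℂ)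
    {Y : Matrix (Fin p × Fin r) (Fin p × Fin r) ℂ} (hY : Y ∈ toeplitzAlgebra r p) :
    HasDerivAt (fun ε : ℝ => traceForm α (truncLog
      (constBlock p (1 + (ε : ℂ) • blockCoeff Y 0)⁻¹ * (1 + (ε : ℂ) • Y) - 1)))
      (traceForm α (Y - constBlock p (blockCoeff Y 0))) 0 := by
  set Y₀ := blockCoeff Y 0 with hY₀
  set K : ℝ → Matrix (Fin p × Fin r) (Fin p × Fin r) ℂ := fun ε =>
    constBlock p (1 + (ε : ℂ) • Y₀)⁻¹ * (Y - constBlock p Y₀) with hK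
  have hc : Continuous fun ε : ℝ => (1 : Matrix (Fin r) (Fin r) ℂ) + (ε : ℂ) • Y₀ :=
    continuous_const.add (Complex.continuous_ofReal.smul continuous_const)
  have hK0 : K 0 = Y - constBlock p Y₀ := by
    simp [hK, constBlock_one]
  have hKc : ContinuousAt K 0 := by
    refine ContinuousAt.mul ?_ continuousAt_const
    refine continuous_constBlock.continuousAt.comp ?_
    refine ContinuousAt.comp (g := fun A : Matrix (Fin r) (Fin r) ℂ => A⁻¹) ?_ hc.continuousAt
    refine continuousAt_matrix_inv _ ?_
    rw [Ring.inverse_eq_inv']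
    exact continuousAt_inv₀ (by simp)
  have h1 : HasDerivAt (fun t : ℝ => t • K t) (Y - constBlock p Y₀) 0 :=
    hK0 ▸ hasDerivAt_smul_of_continuousAt hKc
  have h2 := hasDerivAt_traceForm_truncLog α h1 (by rw [zero_smul]; exact zero_mem _)
    (sub_mem hY (constBlock_mem _))
  have h3 : (∑ k ∈ Finset.range p, (-((0 : ℝ) • K 0)) ^ k) = 1 := by
    rw [zero_smul, neg_zero, Finset.sum_eq_single 0]
    · simp
    · intro k _ hk
      rw [zero_pow hk]
    · intro h
      exact absurd (Finset.mem_range.2 (Nat.pos_of_neZero p)) h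
  rw [h3, one_mul] at h2
  refine h2.congr_of_eventuallyEq ?_
  have h4 : ∀ᶠ ε : ℝ in 𝓝 0, (1 + (ε : ℂ) • Y₀).det ≠ 0 :=
    hc.matrix_det.continuousAt.eventually_ne (by simp)
  filter_upwards [h4] with ε hε
  have h5 : constBlock p (1 + (ε : ℂ) • Y₀)⁻¹ * constBlock p (1 + (ε : ℂ) • Y₀) = 1 :=
    constBlock_inv_mul ((Matrix.isUnit_iff_isUnit_det _).2 (isUnit_iff_ne_zero.2 hε))
  have h6 : constBlock p (1 + (ε : ℂ) • Y₀) = 1 + (ε : ℂ) • constBlock p Y₀ := by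
    refine eq_of_blockCoeff_eq (constBlock_mem _) (add_mem (one_mem _)
      (Subalgebra.smul_mem _ (constBlock_mem _) _)) ?_
    rw [blockCoeff_add, blockCoeff_smul, blockCoeff_one, blockCoeff_constBlock,
      blockCoeff_constBlock, Pi.single_add, Pi.single_smul]
  have h7 : (1 : Matrix (Fin p × Fin r) (Fin p × Fin r) ℂ) + (ε : ℂ) • Y =
      constBlock p (1 + (ε : ℂ) • Y₀) + (ε : ℂ) • (Y - constBlock p Y₀) := by
    rw [h6, smul_sub]
    abel
  rw [h7, mul_add, h5, add_sub_cancel_left, mul_smul_comm, Complex.coe_smul]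

end

/-- The function of the matrix entries which agrees with `jordanCharacter α` near `1`. -/
def localJordanCharacter (α : Fin p → ℂ) (M : Matrix (Fin p × Fin r) (Fin p × Fin r) ℂ) : ℂ :=
  Complex.exp (α 0 * Complex.log (blockCoeff M 0).det) *
    Complex.exp (traceForm α (truncLog (constBlock p (blockCoeff M 0)⁻¹ * M - 1)))

lemma jordanCharacter_eventuallyEq (α : Fin p → ℂ) :
    ∀ᶠ x in 𝓝 (1 : UniversalCover (jordanGroup r p)),
      jordanCharacter α x = localJordanCharacter α
        ((UniversalCover.proj x).1 : Matrix (Fin p × Fin r) (Fin p × Fin r) ℂ) := by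
  have h : Filter.Tendsto (UniversalCover.map (detZero (r := r) (p := p))) (𝓝 1) (𝓝 1) := by
    have := (UniversalCover.continuous_map (detZero (r := r) (p := p))).tendsto 1
    rwa [map_one] at this
  filter_upwards [h.eventually UniversalCover.log_eventuallyEq] with x hx
  rw [jordanCharacter, expTraceTheta_reducedCoeff, logDetZero, hx, UniversalCover.proj_map]
  rfl

lemma localJordanCharacter_ne_zero (α : Fin p → ℂ)
    (M : Matrix (Fin p × Fin r) (Fin p × Fin r) ℂ) : localJordanCharacter α M ≠ 0 :=
  mul_ne_zero (Complex.exp_ne_zero _) (Complex.exp_ne_zero _)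

lemma localJordanCharacter_one (α : Fin p → ℂ) :
    localJordanCharacter (r := r) α (1 : Matrix (Fin p × Fin r) (Fin p × Fin r) ℂ) = 1 := by
  simp [localJordanCharacter, blockCoeff_one, constBlock_one, truncLog, Finset.sum_range_succ']

lemma traceForm_constBlock (α : Fin p → ℂ) (A : Matrix (Fin r) (Fin r) ℂ) :
    traceForm α (constBlock p A) = α 0 * A.trace := by
  rw [traceForm_apply, blockCoeff_constBlock, Finset.sum_eq_single 0]
  · simp
  · intro i _ hi
    simp [hi]
  · simp

/-- The determinant contributes $\alpha_0\mathrm{Tr}\,Y_0$, exactly the part of the trace form that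
is lost on dividing by $h_0$. -/
lemma hasDerivAt_localJordanCharacter (α : Fin p → ℂ)
    {Y : Matrix (Fin p × Fin r) (Fin p × Fin r) ℂ} (hY : Y ∈ toeplitzAlgebra r p) :
    HasDerivAt (fun ε : ℝ => localJordanCharacter α (1 + (ε : ℂ) • Y)) (traceForm α Y) 0 := by
  have hb : ∀ ε : ℝ, blockCoeff (1 + (ε : ℂ) • Y) 0 = 1 + (ε : ℂ) • blockCoeff Y 0 := fun ε => by
    rw [blockCoeff_add, blockCoeff_smul, blockCoeff_one, Pi.add_apply, Pi.single_eq_same,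
      Pi.smul_apply]
  simp only [localJordanCharacter, hb]
  have h1 : HasDerivAt (fun z : ℂ => α 0 * Complex.log (1 + z • blockCoeff Y 0).det)
      (α 0 * (blockCoeff Y 0).trace) 0 := by
    have h2 := ((hasDerivAt_det_one_add_smul (blockCoeff Y 0)).clog (by simp)).const_mul (α 0)
    simpa using h2
  have h3 := (h1.cexp.comp_ofReal (z := 0)).mul (hasDerivAt_truncLog_reduced α hY).cexp
  refine h3.congr_deriv ?_
  have hz : truncLog (0 : Matrix (Fin p × Fin r) (Fin p × Fin r) ℂ) = 0 := by
    simp [truncLog, Finset.sum_range_succ']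
  simp [constBlock_one, hz, traceForm_constBlock]

/-- Every character of the universal covering group of `J_r(p)` is a `jordanCharacter`. -/
theorem exists_eq_jordanCharacter (χ : UniversalCover (jordanGroup r p) →* ℂˣ)
    (hχ : IsCoverCharacter χ) : ∃ α : Fin p → ℂ, ∀ x, (χ x : ℂ) = jordanCharacter α x := by
  obtain ⟨f, hf, hev⟩ := hχ 1
  set F : Matrix (Fin p × Fin r) (Fin p × Fin r) ℂ → ℂ := fun M => f fun i j => M i j with hF
  have hFev : ∀ᶠ x in 𝓝 1, (χ x : ℂ) = F (UniversalCover.proj x).1 := hev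
  have hF1 : F 1 = 1 := by
    have := hFev.self_of_nhds
    rw [map_one, map_one] at this
    exact this.symm
  set L : Matrix (Fin p × Fin r) (Fin p × Fin r) ℂ →ₗ[ℂ] ℂ :=
    (fderiv ℂ f fun i j => (1 : Matrix (Fin p × Fin r) (Fin p × Fin r) ℂ) i j).toLinearMap ∘ₗ
      (Matrix.ofLinearEquiv ℂ).symm.toLinearMap with hLdef
  have hL : ∀ Y : Matrix (Fin p × Fin r) (Fin p × Fin r) ℂ,
      HasDerivAt (fun ε : ℝ => F (1 + (ε : ℂ) • Y)) (L Y) 0 := by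
    intro Y
    have h1 : HasDerivAt (fun ε : ℝ => fun i j =>
        (1 + (ε : ℂ) • Y : Matrix (Fin p × Fin r) (Fin p × Fin r) ℂ) i j) (fun i j => Y i j) 0 := by
      refine hasDerivAt_pi.2 fun i => hasDerivAt_pi.2 fun j => ?_
      have := ((Complex.ofRealCLM.hasDerivAt (x := 0)).mul_const (Y i j)).const_add
        ((1 : Matrix (Fin p × Fin r) (Fin p × Fin r) ℂ) i j)
      simpa using this
    have h2 : HasFDerivAt f
        (fderiv ℂ f fun i j => (1 : Matrix (Fin p × Fin r) (Fin p × Fin r) ℂ) i j)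
        (fun i j => (1 + ((0 : ℝ) : ℂ) • Y : Matrix (Fin p × Fin r) (Fin p × Fin r) ℂ) i j) := by
      rw [Complex.ofReal_zero, zero_smul, add_zero]
      exact hf.differentiableAt.hasFDerivAt
    exact (h2.restrictScalars ℝ).comp_hasDerivAt (0 : ℝ) h1
  obtain ⟨α, hα⟩ := exists_eq_traceForm (L := L) fun A hA B hB =>
    differential_mul_comm hFev (fun Y _ => hL Y) hA hB
  refine ⟨α, fun x => ?_⟩
  -- Numerator and denominator have value $1$ and the same differential at $1$, so the quotient has
  -- zero differential.
  set ψ : UniversalCover (jordanGroup r p) →* ℂˣ := χ / jordanCharacterHom α with hψ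
  have key : ψ x = 1 := by
    refine eq_one_of_hasDerivAt ψ
      (fun M => F M / localJordanCharacter α M) ?_ (fun Y hY => ?_) x
    · filter_upwards [hFev, jordanCharacter_eventuallyEq α] with y hy hy'
      rw [hψ, MonoidHom.div_apply, Units.val_div_eq_div_val, hy, jordanCharacterHom_apply, hy']
    · refine ((hL Y).fun_div (hasDerivAt_localJordanCharacter α hY)
        (localJordanCharacter_ne_zero α _)).congr_deriv ?_
      rw [Complex.ofReal_zero, zero_smul, add_zero, hF1, localJordanCharacter_one, hα Y hY]
      simp
  rw [hψ, MonoidHom.div_apply, div_eq_one] at key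
  rw [key, jordanCharacterHom_apply]

end JordanCharacters

/-! ### Characters of the product group $H_\lambda$ -/

lemma MonoidHom.apply_eq_prod_mulSingle {ι K : Type*} [Fintype ι] [DecidableEq ι] [CommMonoid K]
    {G : ι → Type*} [∀ i, Monoid (G i)] (f : (∀ i, G i) →* K) (x : ∀ i, G i) :
    f x = ∏ i, f (Pi.mulSingle i (x i)) := by
  conv_lhs => rw [← Finset.noncommProd_mulSingle x]
  exact (Finset.map_noncommProd _ _ _ f).trans (Finset.noncommProd_eq_prod _ _)

section ProductGroup

variable {r ℓ : ℕ} {n : Fin ℓ → ℕ}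

/-- The block diagonal matrix with `k`-th block `e` and all other blocks `1`. -/
def blockEntries (r : ℕ) (n : Fin ℓ → ℕ) (k : Fin ℓ) (e : Fin (n k) × Fin r → Fin (n k) × Fin r → ℂ)
    (x y : Σ k, Fin (n k) × Fin r) : ℂ :=
  Matrix.blockDiagonal' (Function.update
    (fun j => (1 : Matrix (Fin (n j) × Fin r) (Fin (n j) × Fin r) ℂ)) k (Matrix.of e)) x y

lemma analyticAt_blockEntries (k : Fin ℓ) (e : Fin (n k) × Fin r → Fin (n k) × Fin r → ℂ) :
    AnalyticAt ℂ (blockEntries r n k) e := by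
  refine analyticAt_pi_iff.2 fun ⟨i, a⟩ => analyticAt_pi_iff.2 fun ⟨j, b⟩ => ?_
  by_cases hij : i = j
  · subst hij
    simp only [blockEntries, Matrix.blockDiagonal'_apply_eq]
    by_cases hik : i = k
    · subst hik
      simp only [Function.update_self, Matrix.of_apply]
      exact ((ContinuousLinearMap.proj (R := ℂ) (φ := fun _ : Fin (n i) × Fin r => ℂ) b).comp
        (ContinuousLinearMap.proj (R := ℂ)
          (φ := fun _ : Fin (n i) × Fin r => Fin (n i) × Fin r → ℂ) a)).analyticAt e
    · simp only [Function.update_of_ne hik]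
      exact analyticAt_const
  · simp only [blockEntries, Matrix.blockDiagonal'_apply_ne _ _ _ hij]
    exact analyticAt_const

variable [∀ k, NeZero (n k)]

lemma continuous_blockDiagHom : Continuous (blockDiagHom r n) := by
  have h : Continuous fun g : ∀ k, jordanGroup r (n k) => Matrix.blockDiagonal' fun k =>
      ((g k).1 : Matrix (Fin (n k) × Fin r) (Fin (n k) × Fin r) ℂ) :=
    Continuous.matrix_blockDiagonal' (continuous_pi fun k =>
      continuous_coe_jordanGroup.comp (continuous_apply k))
  rw [Units.continuous_iff]
  exact ⟨h, h.comp continuous_inv⟩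

/-- The continuous homomorphism `J_r(n_k) → H_λ` onto the `k`-th factor. -/
def hIncl (k : Fin ℓ) : jordanGroup r (n k) →ₜ* hGroup r n where
  toMonoidHom := (blockDiagHom r n).rangeRestrict.comp (MonoidHom.mulSingle (fun j => jordanGroup r (n j)) k)
  continuous_toFun :=
    (continuous_blockDiagHom.comp (continuous_mulSingle k)).subtype_mk _

/-- The path in `H_λ` with given blocks. -/
def pathOfBlocks : (∀ k, pathGroup (jordanGroup r (n k))) →* pathGroup (hGroup r n) where
  toFun γ := ⟨⟨fun t => (blockDiagHom r n).rangeRestrict fun k => (γ k).1 t,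
    (continuous_blockDiagHom.comp
      (continuous_pi fun k => (γ k).1.continuous)).subtype_mk _⟩, by
    have h : (fun k => (γ k).1 0) = 1 := funext fun k => (γ k).2
    change (blockDiagHom r n).rangeRestrict (fun k => (γ k).1 0) = 1
    rw [h, map_one]⟩
  map_one' := Subtype.ext (ContinuousMap.ext fun _ => map_one (blockDiagHom r n).rangeRestrict)
  map_mul' _ _ := Subtype.ext (ContinuousMap.ext fun _ =>
    map_mul (blockDiagHom r n).rangeRestrict _ _)

lemma pathOfBlocks_apply (γ : ∀ k, pathGroup (jordanGroup r (n k))) (t : I) :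
    (pathOfBlocks γ).1 t = (blockDiagHom r n).rangeRestrict fun k => (γ k).1 t := rfl

lemma pathOfBlocks_mulSingle (k : Fin ℓ) (γ : pathGroup (jordanGroup r (n k))) :
    pathOfBlocks (Pi.mulSingle k γ) = UniversalCover.mapPath (hIncl k) γ := by
  refine Subtype.ext (ContinuousMap.ext fun t => ?_)
  rw [pathOfBlocks_apply]
  change _ = (blockDiagHom r n).rangeRestrict (Pi.mulSingle k (γ.1 t))
  congr 1
  funext j
  by_cases hj : j = k
  · subst hj; simp
  · simp [hj]

lemma pathOfBlocks_hBlock (γ : pathGroup (hGroup r n)) :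
    pathOfBlocks (fun k => UniversalCover.mapPath (hBlock k) γ) = γ := by
  refine Subtype.ext (ContinuousMap.ext fun t => ?_)
  exact (MonoidHom.ofInjective (blockDiagHom_injective (r := r) (n := n))).apply_symm_apply (γ.1 t)

/-- A path in $H_\lambda$ is the pointwise product of its block components. Working with paths
avoids identifying the cover of a product with the product of the covers. -/
lemma apply_eq_prod_hIncl {K : Type*} [CommGroup K] (χ : UniversalCover (hGroup r n) →* K)
    (x : UniversalCover (hGroup r n)) :
    χ x = ∏ k, χ (UniversalCover.map (hIncl k) (UniversalCover.map (hBlock k) x)) := by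
  obtain ⟨γ, rfl⟩ := QuotientGroup.mk_surjective x
  have h := MonoidHom.apply_eq_prod_mulSingle
    ((χ.comp (QuotientGroup.mk' (nullLoops (hGroup r n)))).comp pathOfBlocks)
    (fun k => UniversalCover.mapPath (hBlock k) γ)
  simp only [MonoidHom.comp_apply, pathOfBlocks_hBlock, pathOfBlocks_mulSingle] at h
  exact h

lemma entries_hIncl (k : Fin ℓ) (g : jordanGroup r (n k)) :
    entries (hIncl k g).1 = blockEntries r n k (entries g.1) := by
  funext x y
  change Matrix.blockDiagonal' (fun j => ((Pi.mulSingle (M := fun j => jordanGroup r (n j)) k g j).1 :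
    Matrix (Fin (n j) × Fin r) (Fin (n j) × Fin r) ℂ)) x y = _
  rw [blockEntries]
  congr 2
  funext j
  by_cases hj : j = k
  · subst hj
    simp only [Pi.mulSingle_eq_same, Function.update_self]
    rfl
  · rw [Pi.mulSingle_eq_of_ne hj, Function.update_of_ne hj]
    rfl

/-- In matrix entries the inclusion of a factor is the analytic map `blockEntries`, so local
holomorphic expressions pull back. -/
lemma IsCoverCharacter.comp_hIncl {χ : UniversalCover (hGroup r n) →* ℂˣ}
    (hχ : IsCoverCharacter χ) (k : Fin ℓ) :
    IsCoverCharacter (χ.comp (UniversalCover.map (hIncl k))) := by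
  intro y
  obtain ⟨f, hf, hev⟩ := hχ (UniversalCover.map (hIncl k) y)
  have he : ∀ z, entries (UniversalCover.proj (UniversalCover.map (hIncl k) z)).1 =
      blockEntries r n k (entries (UniversalCover.proj z).1) := fun z => by
    rw [UniversalCover.proj_map, entries_hIncl]
  refine ⟨f ∘ blockEntries r n k, ?_, ?_⟩
  · refine AnalyticAt.comp ?_ (analyticAt_blockEntries k _)
    rw [← he]
    exact hf
  · filter_upwards [(UniversalCover.continuous_map (hIncl k)).continuousAt.eventually hev]
      with z hz
    rw [MonoidHom.comp_apply, hz, he]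
    rfl

end ProductGroup

end

theorem mainTheorem5 (r : ℕ) :
    (∀ (p : ℕ) [NeZero p],
      -- restrictions to the unipotent group of characters of the universal cover of `J_r(p)`
      (∀ χ : UniversalCover (jordanGroup r p) →* ℂˣ, IsCoverCharacter χ →
        ∃ α : Fin p → ℂ, ∀ h : unipotentGroup r p,
          (χ (unipotentLift h) : ℂ) = expTraceTheta α (jordanCoeff h.1)) ∧
      -- conversely, these formulas define characters of the unipotent group
      (∀ α : Fin p → ℂ, ∃ ψ : unipotentGroup r p →* ℂˣ, IsCharacter ψ ∧
        ∀ h : unipotentGroup r p, (ψ h : ℂ) = expTraceTheta α (jordanCoeff h.1)) ∧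
      -- characters of the universal cover of `J_r(p)`
      (∀ χ : UniversalCover (jordanGroup r p) →* ℂˣ, IsCoverCharacter χ →
        ∃ α : Fin p → ℂ, ∀ x, (χ x : ℂ) = jordanCharacter α x)) ∧
    -- characters of the universal cover of `H_λ`
    (∀ (ℓ : ℕ) (n : Fin ℓ → ℕ) [∀ k, NeZero (n k)]
      (χ : UniversalCover (hGroup r n) →* ℂˣ), IsCoverCharacter χ →
        ∃ (α : ∀ k, Fin (n k) → ℂ) (χ' : ∀ k, UniversalCover (jordanGroup r (n k)) →* ℂˣ),
          (∀ k, IsCoverCharacter (χ' k) ∧ ∀ y, (χ' k y : ℂ) = jordanCharacter (α k) y) ∧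
          ∀ x, χ x = ∏ k, χ' k (UniversalCover.map (hBlock k) x)) := by
  refine ⟨fun p _ => ⟨fun χ hχ => ?_, fun α => ⟨unipotentCharacter α,
    isCharacter_unipotentCharacter α, unipotentCharacter_apply α⟩, exists_eq_jordanCharacter⟩,
    fun ℓ n _ χ hχ => ?_⟩
  · obtain ⟨α, hα⟩ := exists_eq_jordanCharacter χ hχ
    exact ⟨α, fun h => (hα _).trans (jordanCharacter_unipotentLift α h)⟩
  · choose α hα using fun k => exists_eq_jordanCharacter _ (hχ.comp_hIncl k)
    -- The factors are the restrictions of `χ`, so their holomorphy is inherited from `χ`, not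
    -- derived from the explicit formula.
    exact ⟨α, fun k => χ.comp (UniversalCover.map (hIncl k)),
      fun k => ⟨hχ.comp_hIncl k, hα k⟩, fun x => apply_eq_prod_hIncl χ x⟩
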